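/- All graphs are finite and simple. In the eternal vertex cover game on $G$, guards stand on distinct vertices; when an edge is attacked, all guards move in parallel, each staying or moving to an adjacent vertex, never two on the same vertex, and at least one guard must cross the attacked edge. An \emph{eternal vertex cover class} of $G$ is a family $\mathcal C$ of vertex covers of $G$ of the same cardinality such that from every member of $\mathcal C$ every attack can be defended by moving to a member of $\mathcal C$; $\mathrm{evc}(G)$ is the minimum cardinality of a member of an eternal vertex cover class of $G$. \textbf{Corollary.} The following promise problem is in NP: given a connected graph $G$ in which every minimum vertex cover induces a connected subgraph, and an integer $k\ge 0$ (written in binary), decide whether $\mathrm{evc}(G)\le k$. That is, there are a polynomial-time verifier $V$ and a polynomial $p$ such that for every such $(G,k)$ with encoding $x$ we have $\mathrm{evc}(G)\le k$ if and only if $V$ accepts $(x,c)$ for some string $c$ of length at most $p(|x|)$. Moreover, $V$ and $p$ can be chosen so that, for every graph $G$ with at least two vertices and every $k\le |V(G)|$ (whether or not $G$ satisfies the promise), the strings $c$ for which $V$ accepts $(x,c)$ are exactly the encodings of the families $(S_v)_{v\in V(G)}$ in which, for each vertex $v$, $S_v$ is a vertex cover of $G$ of size $k$ containing $v$; and the encoding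 of any family of $|V(G)|$ subsets of $V(G)$ indexed by $V(G)$ has length at most $p(|x|)$. -/

import Mathlib

/-! ### Eternal vertex cover -/

namespace EVC

section Graph

variable {V : Type*}

/-- `S` is a vertex cover of `G` of minimum cardinality. -/
def IsMinimumVertexCover (G : SimpleGraph V) (S : Finset V) : Prop :=
  G.IsVertexCover (S : Set V) ∧
    ∀ T : Finset V, G.IsVertexCover (T : Set V) → S.card ≤ T.card

/-- The guards standing on `S` can respond to an attack on the edge `uv` by moving to `T`:
all guards move in parallel (the guard on `w` goes to `f w`), each of them stays or moves to an
adjacent vertex, no two of them end up on the same vertex, and at least one of them crosses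
the attacked edge. -/
def Defends (G : SimpleGraph V) (S T : Finset V) (u v : V) : Prop :=
  ∃ f : V → V, Set.BijOn f (S : Set V) (T : Set V) ∧
    (∀ w ∈ S, f w = w ∨ G.Adj w (f w)) ∧
    ((u ∈ S ∧ f u = v) ∨ (v ∈ S ∧ f v = u))

/-- `C` is an eternal vertex cover class of `G` with `k` guards: a family of vertex covers of
cardinality `k` such that from every member of `C` every attack can be defended by moving to a
member of `C`, so that starting anywhere in `C` one can defend forever within `C`. -/
def IsEternalVertexCoverClass (G : SimpleGraph V) (k : ℕ) (C : Set (Finset V)) : Prop :=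
  (∀ S ∈ C, G.IsVertexCover (S : Set V) ∧ S.card = k) ∧
    ∀ S ∈ C, ∀ u v : V, G.Adj u v → ∃ T ∈ C, Defends G S T u v

/-- `S` is a configuration of some eternal vertex cover class of `G`. -/
def IsEternalVertexCover (G : SimpleGraph V) (S : Finset V) : Prop :=
  ∃ C : Set (Finset V), IsEternalVertexCoverClass G S.card C ∧ S ∈ C

/-- The set of all vertices is an eternal vertex cover; hence the minimum defining `evc` is
taken over a nonempty set. -/
theorem isEternalVertexCover_univ [Fintype V] (G : SimpleGraph V) :
    IsEternalVertexCover G Finset.univ := by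
  classical
  refine ⟨{Finset.univ}, ⟨?_, ?_⟩, rfl⟩
  · rintro S rfl
    simp
  · rintro S rfl u v h
    refine ⟨Finset.univ, rfl, Equiv.swap u v, ?_, ?_, ?_⟩
    · simpa using (Equiv.swap u v).bijective
    · intro w _
      by_cases hu : w = u
      · subst hu; right; simpa using h
      by_cases hv : w = v
      · subst hv; right; simpa using h.symm
      · left; exact Equiv.swap_apply_of_ne_of_ne hu hv
    · left; simp

/-- The eternal vertex cover number: the minimum cardinality of an eternal vertex cover. -/
noncomputable def evc (G : SimpleGraph V) : ℕ :=
  sInf {k : ℕ | ∃ S : Finset V, IsEternalVertexCover G S ∧ S.card = k}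

/-- The connected graphs in which every minimum vertex cover is connected, that is, induces a
connected subgraph. (The empty set is a minimum vertex cover of a connected graph only for the
one-vertex graph; that graph is included here.) -/
def AllMinimumVertexCoversConnected (G : SimpleGraph V) : Prop :=
  G.Connected ∧
    ∀ S : Finset V, IsMinimumVertexCover G S → (G.induce (S : Set V)).Preconnected

/-- `S` consists of, for each vertex `v`, a vertex cover `S v` of `G` of size `k` containing `v`. -/
def IsCertificate (G : SimpleGraph V) (k : ℕ) (S : V → Finset V) : Prop :=
  ∀ v : V, v ∈ S v ∧ G.IsVertexCover (S v : Set V) ∧ (S v).card = k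

end Graph

/-! ### The class NP, for decision problems with a promise on the input -/

/-- A decision problem on strings over `Γ` with a promise: for a string in `promise` it has to be
decided whether the string is in `lang`. -/
structure PromiseProblem (Γ : Type) where
  promise : Set (List Γ)
  lang : Set (List Γ)

/-- `V` is a verifier that puts `P` in NP: it is computed by a (multi-stack) Turing machine in time
polynomial in the length of its input, a pair consisting of an instance and a certificate, and an
instance `x` in the promise is a yes-instance if and only if `V` accepts it together with some
certificate of length at most `p |x|`. -/
structure IsNPVerifier {Γ : Type} (P : PromiseProblem Γ) (V : List Γ × List Γ → Bool)
    (p : Polynomial ℕ) : Prop where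
  polyTime : Nonempty (Turing.TM2ComputableInPolyTime
    (Computability.encodingProd (Computability.encodingList Γ)
      (Computability.encodingList Γ)).encode Computability.encodeBool V)
  correct : ∀ x ∈ P.promise,
    (x ∈ P.lang ↔ ∃ c : List Γ, c.length ≤ p.eval x.length ∧ V (x, c) = true)

/-- `P` is in NP. -/
def InNP {Γ : Type} (P : PromiseProblem Γ) : Prop :=
  ∃ (V : List Γ × List Γ → Bool) (p : Polynomial ℕ), IsNPVerifier P V p

/-! ### Instances and certificates as strings -/

/-- The alphabet: the two bits `some false`, `some true` and a separator `none`. -/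
abbrev Symbol : Type := Option Bool

/-- A square bit matrix as a string: row after row, with a separator after each row. -/
def encodeMatrix {n : ℕ} (M : Fin n → Fin n → Bool) : List Symbol :=
  (List.finRange n).flatMap fun i => (List.finRange n).map (fun j => some (M i j)) ++ [none]

open Classical in
/-- The pair `(G, k)` as a string: the number `k` in binary, a separator, and the adjacency matrix
of `G`. -/
noncomputable def encodeInstance {n : ℕ} (G : SimpleGraph (Fin n)) (k : ℕ) : List Symbol :=
  (Computability.encodeNat k).map some ++ [none] ++ encodeMatrix fun i j => decide (G.Adj i j)

theorem length_encodeMatrix {n : ℕ} (M : Fin n → Fin n → Bool) : (encodeMatrix M).length = n * (n+1) := by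
  simp [encodeMatrix, List.length_flatMap]

theorem append_none_cancel (a a' : List Bool) (l l' : List Symbol)
   (h : a.map some ++ none :: l = a'.map some ++ none :: l') : a = a' ∧ l = l' := by
  induction a generalizing a' with
  | nil => cases a' <;> simp_all
  | cons b a ih => cases a' with
    | nil => simp at h
    | cons c a' =>
      simp only [List.map_cons, List.cons_append, List.cons.injEq, Option.some.injEq] at h
      obtain ⟨h1,h2⟩ := ih a' h.2
      simp [h.1,h1,h2]

theorem rows_injective {n : ℕ} (L : List (Fin n)) (M M' : Fin n → Fin n → Bool)
  (h : (L.flatMap fun i => (List.finRange n).map (fun j => some (M i j)) ++ [none]) =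
    (L.flatMap fun i => (List.finRange n).map (fun j => some (M' i j)) ++ [none])) :
   ∀ i ∈ L, M i = M' i := by
  induction L with
  | nil => simp
  | cons i L ih =>
    simp only [List.flatMap_cons, List.append_assoc, List.singleton_append] at h
    have e : ∀ N : Fin n → Fin n → Bool, (List.finRange n).map (fun j => some (N i j)) = ((List.finRange n).map (N i)).map some := by
      intro N; simp
    rw [e, e] at h
    obtain ⟨h1, h2⟩ := append_none_cancel _ _ _ _ h
    intro j hj
    rcases List.mem_cons.1 hj with rfl | hj
    · funext x; exact (List.map_inj_left.1 h1) x (List.mem_finRange x)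
    · exact ih h2 j hj

/-- An instance is determined by its string. -/
theorem encodeInstance_injective {n m : ℕ} (G : SimpleGraph (Fin n)) (H : SimpleGraph (Fin m)) (k l : ℕ)
  (h : encodeInstance G k = encodeInstance H l) : k = l ∧ ∃ e : n = m, e ▸ G = H := by
  classical
  simp only [encodeInstance, List.append_assoc, List.singleton_append] at h
  obtain ⟨h1,h2⟩ := append_none_cancel _ _ _ _ h
  have hk : k = l := by simpa using congrArg Computability.decodeNat h1
  have hl := congrArg List.length h2
  rw [length_encodeMatrix, length_encodeMatrix] at hl
  have hn : n = m := by nlinarith [lt_trichotomy n m]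
  subst hn
  refine ⟨hk, rfl, ?_⟩
  ext i j
  have := congrFun (rows_injective _ _ _ h2 i (List.mem_finRange i)) j
  simpa using this

/-- A family of sets of vertices, one set for each vertex, as a string: the matrix whose row `v` is
the indicator vector of `S v`. -/
def encodeCertificate {n : ℕ} (S : Fin n → Finset (Fin n)) : List Symbol :=
  encodeMatrix fun v w => decide (w ∈ S v)

/-- Given a connected graph `G` in which every minimum vertex cover is connected, and a number `k`,
decide whether `evc G ≤ k`. -/
def evcProblem : PromiseProblem Symbol where
  promise := {x | ∃ (n : ℕ) (G : SimpleGraph (Fin n)) (k : ℕ),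
    x = encodeInstance G k ∧ AllMinimumVertexCoversConnected G}
  lang := {x | ∃ (n : ℕ) (G : SimpleGraph (Fin n)) (k : ℕ),
    x = encodeInstance G k ∧ evc G ≤ k}

end EVC

/-! The certificates work because of a combinatorial criterion, `evc_le_iff_exists_isCertificate`:
under the promise, with at least two vertices and `k` at most their number, `evc G ≤ k` holds
exactly when every vertex lies in a vertex cover of size `k`. Necessity uses only connectedness: an
attack on an edge at an unguarded vertex `v` forces a guard onto `v`, and the resulting cover can be
padded to size `k`.

For sufficiency let `τ` be the minimum size of a vertex cover. If `k > τ`, fix a minimum cover `S`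
and use the class of all sets `S ∪ {y}` with `y ∉ S`. An attack on `uv` with `v` unguarded is
answered by shifting guards along a path that leads from the extra guard through `S` to `u`, and on
to `v` (`exists_defends_insert`). If `k = τ`, all minimum covers together form a class
(`exists_defends_of_minimum`). Against an attack on `uv` with `u ∈ S` and `v ∉ S`, choose a minimum
cover `T` through `v` with `S ∩ T` as large as possible. As `S` is connected, some path in `S` runs
from `S \ T` to `u` and meets `S \ T` only in its first vertex `a`; shifting along it vacates `a`
and fills `v`. The other guards of `S \ T` move to `T \ S` along a matching given by Hall's theorem:
a violation of Hall's condition would produce a minimum cover through `v` that meets `S` in more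
vertices (`exists_matching`).

That certificates can be checked in polynomial time is proved with a small language of stack
programs whose loops run by popping. Stacks carry weights, and each pop must pay for all pushes it
triggers. So the weighted size never grows, every loop has at most that many rounds, and induction
over the program bounds the time by a polynomial (`Prog.time_le`); `steps_code` transfers this to
Turing machines.

Since `k` is given in binary and may be exponentially large, its unary form is drawn from a pool
with one token per vertex; if the pool runs dry, then `k > n`. Instances with `k > n` or `n ≤ 1` are
yes-instances and are accepted with every certificate. In all other cases `accepts_iff` identifies
the accepted strings. -/

/-! ### Programs on stacks and their compilation to multi-stack Turing machines -/

namespace StackProgram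

set_option linter.unusedSectionVars false

open Function Turing

variable {K A σ : Type} [DecidableEq K]

/-- An elementary operation: pop the stack `src`; if this gives a symbol `a`, push, for each pair
`(k, v)` in `pushes`, the symbol `v s a` (if there is one) on the stack `k`, where `s` is the
control state. Then update the control state. -/
structure Op (K A σ : Type) where
  src : K
  upd : σ → Option A → σ
  pushes : List (K × (σ → A → Option A))

/-- Programs. A loop pops its source stack until it is empty, with one run of the body for every
symbol. -/
inductive Prog (K A σ : Type) where
  | skip : Prog K A σ
  | act : Op K A σ → Prog K A σ
  | seq : Prog K A σ → Prog K A σ → Prog K A σ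
  | loop : Op K A σ → Prog K A σ → Prog K A σ
  | cond : (σ → Bool) → Prog K A σ → Prog K A σ

/-- The effect of a list of pushes. -/
def pushAll (s : σ) (a : A) : List (K × (σ → A → Option A)) → (K → List A) → K → List A
  | [], S => S
  | p :: ps, S => pushAll s a ps (update S p.1 ((p.2 s a).toList ++ S p.1))

/-- The effect of an operation if `a` has been popped and `l` is left. -/
def Op.succ (o : Op K A σ) (a : A) (l : List A) (st : σ × (K → List A)) : σ × (K → List A) :=
  (o.upd st.1 (some a), pushAll st.1 a o.pushes (update st.2 o.src l))

/-- The effect of an operation if nothing has been popped. -/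
def Op.fail (o : Op K A σ) (st : σ × (K → List A)) : σ × (K → List A) :=
  (o.upd st.1 none, st.2)

/-- The effect of an operation. -/
def Op.eval (o : Op K A σ) (st : σ × (K → List A)) : σ × (K → List A) :=
  match st.2 o.src with
  | [] => o.fail st
  | a :: l => o.succ a l st

/-- The effect of a loop, given the effect of its body. -/
def evalLoop (body : σ × (K → List A) → σ × (K → List A)) (o : Op K A σ) :
    List A → σ × (K → List A) → σ × (K → List A)
  | [], st => o.fail st
  | a :: l, st => evalLoop body o l (body (o.succ a l st))

/-- The effect of a program. -/
def Prog.eval : Prog K A σ → σ × (K → List A) → σ × (K → List A)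
  | .skip, st => st
  | .act o, st => o.eval st
  | .seq p q, st => q.eval (p.eval st)
  | .loop o p, st => evalLoop p.eval o (st.2 o.src) st
  | .cond b p, st => if b st.1 then p.eval st else st

/-- The running time of a loop. -/
def timeLoop (body : σ × (K → List A) → σ × (K → List A)) (t : σ × (K → List A) → ℕ)
    (o : Op K A σ) : List A → σ × (K → List A) → ℕ
  | [], _ => 1
  | a :: l, st => 1 + t (o.succ a l st) + timeLoop body t o l (body (o.succ a l st))

/-- The running time of a program. -/
def Prog.time : Prog K A σ → σ × (K → List A) → ℕ
  | .skip, _ => 1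
  | .act _, _ => 1
  | .seq p q, st => p.time st + q.time (p.eval st)
  | .loop o p, st => timeLoop p.eval p.time o (st.2 o.src) st
  | .cond b p, st => if b st.1 then 1 + p.time st else 1

/-- The operation does not change the stack `k`. -/
def Op.Avoids (o : Op K A σ) (k : K) : Prop := o.src ≠ k ∧ ∀ p ∈ o.pushes, p.1 ≠ k

/-- The program does not change the stack `k`. -/
def Prog.Avoids : Prog K A σ → K → Prop
  | .skip, _ => True
  | .act o, k => o.Avoids k
  | .seq p q, k => p.Avoids k ∧ q.Avoids k
  | .loop o p, k => o.Avoids k ∧ p.Avoids k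
  | .cond _ p, k => p.Avoids k

/-- No loop changes its source stack other than by popping it once in each round. -/
def Prog.WellFormed : Prog K A σ → Prop
  | .skip => True
  | .act _ => True
  | .seq p q => p.WellFormed ∧ q.WellFormed
  | .loop o p => (∀ x ∈ o.pushes, x.1 ≠ o.src) ∧ p.Avoids o.src ∧ p.WellFormed
  | .cond _ p => p.WellFormed

/-- A successful pop pays for all pushes. -/
def Op.Weighted (w : K → ℕ) (o : Op K A σ) : Prop := (o.pushes.map fun p => w p.1).sum ≤ w o.src

/-- Every elementary operation of the program satisfies `P`. -/
def Prog.All (P : Op K A σ → Prop) : Prog K A σ → Prop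
  | .skip => True
  | .act o => P o
  | .seq p q => p.All P ∧ q.All P
  | .loop o p => P o ∧ p.All P
  | .cond _ p => p.All P

/-! ### What a program leaves unchanged, and unfolding of loops -/

theorem pushAll_apply_of_ne {s : σ} {a : A} {k : K} {ps : List (K × (σ → A → Option A))}
    {S : K → List A} (h : ∀ p ∈ ps, p.1 ≠ k) : pushAll s a ps S k = S k := by
  induction ps generalizing S with
  | nil => rfl
  | cons p ps ih =>
    rw [pushAll, ih fun q hq => h q (List.mem_cons_of_mem _ hq),
      update_of_ne (h p List.mem_cons_self).symm]

theorem Op.Avoids.succ {o : Op K A σ} {k : K} (h : o.Avoids k) (a : A) (l : List A)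
    (st : σ × (K → List A)) : (o.succ a l st).2 k = st.2 k := by
  simp only [Op.succ]
  rw [pushAll_apply_of_ne h.2, update_of_ne h.1.symm]

theorem evalLoop_apply {body : σ × (K → List A) → σ × (K → List A)} {o : Op K A σ} {k : K}
    (ho : o.Avoids k) (hb : ∀ st, (body st).2 k = st.2 k) (l : List A) (st : σ × (K → List A)) :
    (evalLoop body o l st).2 k = st.2 k := by
  induction l generalizing st with
  | nil => rfl
  | cons a l ih => rw [evalLoop, ih, hb, ho.succ]

theorem Prog.Avoids.eval {p : Prog K A σ} {k : K} (h : p.Avoids k) (st : σ × (K → List A)) :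
    (p.eval st).2 k = st.2 k := by
  induction p generalizing st with
  | skip => rfl
  | act o =>
    rw [Prog.eval, Op.eval]
    split
    · rfl
    · exact Op.Avoids.succ h _ _ _
  | seq p q ihp ihq => rw [Prog.eval, ihq h.2, ihp h.1]
  | loop o p ih => exact evalLoop_apply h.1 (ih h.2) _ _
  | cond b p ih =>
    rw [Prog.eval]
    split
    · exact ih h _
    · rfl

/-- A reflexive and transitive relation respected by all updates of the control state is respected
by the program. -/
theorem Prog.All.eval_rel {R : σ → σ → Prop} (hrefl : ∀ s, R s s)
    (htrans : ∀ s t u, R s t → R t u → R s u) {p : Prog K A σ}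
    (h : p.All fun o => ∀ s x, R s (o.upd s x)) (st : σ × (K → List A)) :
    R st.1 (p.eval st).1 := by
  induction p generalizing st with
  | skip => exact hrefl _
  | act o =>
    rw [Prog.eval, Op.eval]
    split
    · exact h _ _
    · exact h _ _
  | seq p q ihp ihq => exact htrans _ _ _ (ihp h.1 _) (ihq h.2 _)
  | loop o p ih =>
    rw [Prog.eval]
    generalize st.2 o.src = l
    induction l generalizing st with
    | nil => exact h.1 _ _
    | cons a l ihl => exact htrans _ _ _ (h.1 _ _) (htrans _ _ _ (ih h.2 (o.succ a l st)) (ihl _))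
  | cond b p ih =>
    rw [Prog.eval]
    split
    · exact ih h _
    · exact hrefl _

theorem Op.succ_src {o : Op K A σ} (h : ∀ x ∈ o.pushes, x.1 ≠ o.src) (a : A) (l : List A)
    (st : σ × (K → List A)) : (o.succ a l st).2 o.src = l := by
  simp only [Op.succ]
  rw [pushAll_apply_of_ne h, update_self]

theorem Prog.eval_seq (p q : Prog K A σ) (st : σ × (K → List A)) :
    (Prog.seq p q).eval st = q.eval (p.eval st) := rfl

theorem Prog.eval_cond (b : σ → Bool) (p : Prog K A σ) (st : σ × (K → List A)) :
    (Prog.cond b p).eval st = if b st.1 then p.eval st else st := rfl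

theorem Prog.eval_loop_nil {o : Op K A σ} {p : Prog K A σ} {st : σ × (K → List A)}
    (h : st.2 o.src = []) : (Prog.loop o p).eval st = o.fail st := by
  rw [Prog.eval, h, evalLoop]

/-- `eval` fixes the rounds of a loop on entry. As the body does not touch the source, the remaining
rounds are a fresh run of the same loop; inductions on the contents of the source rest on this. -/
theorem Prog.eval_loop_cons {o : Op K A σ} {p : Prog K A σ} (hp : (Prog.loop o p).WellFormed)
    {st : σ × (K → List A)} {a : A} {l : List A} (h : st.2 o.src = a :: l) :
    (Prog.loop o p).eval st = (Prog.loop o p).eval (p.eval (o.succ a l st)) := by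
  rw [Prog.eval, Prog.eval, h, evalLoop, hp.2.1.eval, Op.succ_src hp.1]

/-! ### Polynomial time from non-increasing weighted size -/

section Size

variable [Fintype K] (w : K → ℕ)

/-- The weighted number of symbols on the stacks. -/
def size (S : K → List A) : ℕ := ∑ k, w k * (S k).length

theorem size_update (S : K → List A) (k : K) (l : List A) :
    size w (update S k l) + w k * (S k).length = size w S + w k * l.length := by
  have h : ∀ T : K → List A, size w T = w k * (T k).length +
      ∑ j ∈ Finset.univ.erase k, w j * (T j).length := fun T =>
    (Finset.add_sum_erase _ _ (Finset.mem_univ k)).symm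
  rw [h, h S, update_self, Finset.sum_congr rfl fun j hj => by
    rw [update_of_ne (Finset.ne_of_mem_erase hj)]]
  ring

theorem size_pushAll_le (s : σ) (a : A) (ps : List (K × (σ → A → Option A))) (S : K → List A) :
    size w (pushAll s a ps S) ≤ size w S + (ps.map fun p => w p.1).sum := by
  induction ps generalizing S with
  | nil => simp [pushAll]
  | cons p ps ih =>
    rw [pushAll]
    refine (ih _).trans ?_
    have h := size_update w S p.1 ((p.2 s a).toList ++ S p.1)
    have h' : ((p.2 s a).toList).length ≤ 1 := by cases p.2 s a <;> simp
    rw [List.length_append, mul_add] at h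
    have h'' := Nat.mul_le_mul_left (w p.1) h'
    simp only [List.map_cons, List.sum_cons]
    omega

variable {w}

theorem Op.Weighted.size_succ_le {o : Op K A σ} (h : o.Weighted w) {a : A} {l : List A}
    {st : σ × (K → List A)} (hl : st.2 o.src = a :: l) :
    size w (o.succ a l st).2 ≤ size w st.2 := by
  have h1 := size_pushAll_le w st.1 a o.pushes (update st.2 o.src l)
  have h2 := size_update w st.2 o.src l
  rw [hl, List.length_cons, mul_add] at h2
  have h3 : _ ≤ _ := h
  simp only [Op.succ]
  omega

theorem length_le_size (hw : ∀ k, 1 ≤ w k) (S : K → List A) (k : K) :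
    (S k).length ≤ size w S := by
  have := Finset.single_le_sum (f := fun k => w k * (S k).length) (fun _ _ => Nat.zero_le _)
    (Finset.mem_univ k)
  have := Nat.mul_le_mul_right (S k).length (hw k)
  simp only [size]
  omega

theorem Prog.size_eval_le {p : Prog K A σ} (hp : p.WellFormed) (h : p.All (Op.Weighted w))
    (st : σ × (K → List A)) : size w (p.eval st).2 ≤ size w st.2 := by
  induction p generalizing st with
  | skip => exact le_rfl
  | act o =>
    rw [Prog.eval, Op.eval]
    split
    · exact le_rfl
    · next h' => exact Op.Weighted.size_succ_le h h'
  | seq p q ihp ihq => exact (ihq hp.2 h.2 _).trans (ihp hp.1 h.1 _)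
  | loop o p ih =>
    rw [Prog.eval]
    generalize hl : st.2 o.src = l
    induction l generalizing st with
    | nil => exact le_rfl
    | cons a l ihl =>
      refine (ihl _ ?_).trans ((ih hp.2.2 h.2 _).trans (h.1.size_succ_le hl))
      rw [hp.2.1.eval, Op.succ_src hp.1]
  | cond b p ih =>
    rw [Prog.eval]
    split
    · exact ih hp h _
    · exact le_rfl

/-- A polynomial bound for the running time in terms of the size. -/
noncomputable def Prog.bound : Prog K A σ → Polynomial ℕ
  | .skip => 1
  | .act _ => 1
  | .seq p q => p.bound + q.bound
  | .loop _ p => 1 + Polynomial.X * (1 + p.bound)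
  | .cond _ p => 1 + p.bound

theorem eval_mono (p : Polynomial ℕ) {m n : ℕ} (h : m ≤ n) : p.eval m ≤ p.eval n := by
  rw [Polynomial.eval_eq_sum, Polynomial.eval_eq_sum]
  exact Finset.sum_le_sum fun i _ => Nat.mul_le_mul_left _ (Nat.pow_le_pow_left h i)

/-- A loop has as many rounds as symbols on its source, at most the size because weights are
positive; each round starts with a size no larger than the initial one. -/
theorem Prog.time_le (hw : ∀ k, 1 ≤ w k) {p : Prog K A σ} (hp : p.WellFormed)
    (h : p.All (Op.Weighted w)) (st : σ × (K → List A)) :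
    p.time st ≤ p.bound.eval (size w st.2) := by
  induction p generalizing st with
  | skip => simp [Prog.time, Prog.bound]
  | act o => simp [Prog.time, Prog.bound]
  | seq p q ihp ihq =>
    rw [Prog.time, Prog.bound, Polynomial.eval_add]
    exact Nat.add_le_add (ihp hp.1 h.1 _)
      ((ihq hp.2 h.2 _).trans (eval_mono _ (p.size_eval_le hp.1 h.1 _)))
  | loop o p ih =>
    -- The bound `N` stays fixed while the configuration changes from round to round, so all rounds
    -- share the estimate `p.bound.eval N`.
    have key : ∀ (N : ℕ) (l : List A) (st : σ × (K → List A)), st.2 o.src = l →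
        size w st.2 ≤ N →
        timeLoop p.eval p.time o l st ≤ 1 + l.length * (1 + p.bound.eval N) := by
      intro N l
      induction l with
      | nil => intro st _ _; simp [timeLoop]
      | cons a l ihl =>
        intro st hl hN
        have h1 := (h.1.size_succ_le hl).trans hN
        have h2 := (ih hp.2.2 h.2 (o.succ a l st)).trans (eval_mono _ h1)
        have h3 := ihl (p.eval (o.succ a l st)) (by rw [hp.2.1.eval, Op.succ_src hp.1])
          ((p.size_eval_le hp.2.2 h.2 _).trans h1)
        rw [timeLoop, List.length_cons, add_mul]
        omega
    refine (key _ _ _ rfl le_rfl).trans ?_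
    simp only [Prog.bound, Polynomial.eval_add, Polynomial.eval_mul, Polynomial.eval_X,
      Polynomial.eval_one]
    have := Nat.mul_le_mul_right (1 + p.bound.eval (size w st.2)) (length_le_size hw st.2 o.src)
    omega
  | cond b p ih =>
    have := ih hp h st
    simp only [Prog.time, Prog.bound, Polynomial.eval_add, Polynomial.eval_one]
    split <;> omega

end Size

/-! #### Compilation -/

/-- Labels of the compiled program. -/
def Prog.Label : Prog K A σ → Type
  | .skip => Unit
  | .act _ => Unit
  | .seq p q => p.Label ⊕ q.Label
  | .loop _ p => Option p.Label
  | .cond _ p => Option p.Label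

/-- There are finitely many labels. -/
@[reducible]
noncomputable def Prog.fintypeLabel : (p : Prog K A σ) → Fintype p.Label
  | .skip => inferInstanceAs (Fintype Unit)
  | .act _ => inferInstanceAs (Fintype Unit)
  | .seq p q =>
    letI := p.fintypeLabel
    letI := q.fintypeLabel
    inferInstanceAs (Fintype (p.Label ⊕ q.Label))
  | .loop _ p =>
    letI := p.fintypeLabel
    inferInstanceAs (Fintype (Option p.Label))
  | .cond _ p =>
    letI := p.fintypeLabel
    inferInstanceAs (Fintype (Option p.Label))

/-- The first label of the compiled program. -/
def Prog.entry : (p : Prog K A σ) → p.Label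
  | .skip => ()
  | .act _ => ()
  | .seq p _ => Sum.inl p.entry
  | .loop _ _ => none
  | .cond _ _ => none

/-- The stacks of the machine are those of the program and one more, for the output. -/
abbrev Alphabet (K A B : Type) : Option K → Type
  | none => B
  | some _ => A

variable {B Λ : Type} [Inhabited A]

/-- The machine stores the popped symbol in its control state. -/
abbrev Code (K A B Λ σ : Type) : Type := TM2.Stmt (Alphabet K A B) Λ (σ × Option A)

/-- The code for a list of pushes. -/
def pushCode : List (K × (σ → A → Option A)) → Code K A B Λ σ → Code K A B Λ σ
  | [], q => q
  | p :: ps, q => .branch (fun v => (v.2.bind (p.2 v.1)).isSome)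
      (.push (some p.1) (fun v => (v.2.bind (p.2 v.1)).getD default) (pushCode ps q))
      (pushCode ps q)

/-- The code of an operation that goes to `l` if it pops a symbol and to `l'` otherwise. -/
def Op.code (o : Op K A σ) (l l' : Λ) : Code K A B Λ σ :=
  .pop (some o.src) (fun v x => (v.1, x)) <| .branch (fun v => v.2.isSome)
    (pushCode o.pushes <| .load (fun v => (o.upd v.1 v.2, none)) <| .goto fun _ => l)
    (.load (fun v => (o.upd v.1 v.2, none)) <| .goto fun _ => l')

/-- The code of a program, its labels being embedded in the labels of a larger machine. -/
def Prog.code : (p : Prog K A σ) → (p.Label → Λ) → Λ → p.Label → Code K A B Λ σ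
  | .skip, _, exit, _ => .goto fun _ => exit
  | .act o, _, exit, _ => o.code exit exit
  | .seq p q, e, _, .inl l => p.code (fun x => e (.inl x)) (e (.inr q.entry)) l
  | .seq _ q, e, exit, .inr l => q.code (fun x => e (.inr x)) exit l
  | .loop o p, e, exit, none => o.code (e (some p.entry)) exit
  | .loop _ p, e, _, some l => p.code (fun x => e (some x)) (e none) l
  | .cond b p, e, exit, none =>
    .branch (fun v => b v.1) (.goto fun _ => e (some p.entry)) (.goto fun _ => exit)
  | .cond _ p, e, exit, some l => p.code (fun x => e (some x)) exit l

/-- The stacks of the machine while it simulates a program. -/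
def stks (S : K → List A) : (k : Option K) → List (Alphabet K A B k)
  | none => []
  | some k => S k

/-- The configuration of the machine while it simulates a program. -/
def config (l : Λ) (st : σ × (K → List A)) : TM2.Cfg (Alphabet K A B) Λ (σ × Option A) :=
  ⟨some l, (st.1, none), stks st.2⟩

theorem update_stks (S : K → List A) (k : K) (l : List A) :
    update (stks (B := B) S) (some k) l = stks (update S k l) := by
  funext j
  cases j with
  | none => rfl
  | some j =>
    by_cases h : j = k
    · subst h; simp [stks]
    · simp [stks, h]

theorem stepAux_pushCode (s : σ) (a : A) (ps : List (K × (σ → A → Option A)))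
    (q : Code K A B Λ σ) (S : K → List A) :
    TM2.stepAux (pushCode ps q) (s, some a) (stks S) =
      TM2.stepAux q (s, some a) (stks (pushAll s a ps S)) := by
  induction ps generalizing S with
  | nil => rfl
  | cons p ps ih =>
    rw [pushCode, pushAll, TM2.stepAux]
    cases h : p.2 s a with
    | none => simpa [h] using ih S
    | some b =>
      simp only [Option.bind_some, h, Option.isSome_some, cond_true, TM2.stepAux, Option.getD_some]
      rw [update_stks, ih]
      rfl

theorem stepAux_code_succ (o : Op K A σ) (l l' : Λ) (st : σ × (K → List A)) {a : A} {r : List A}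
    (h : st.2 o.src = a :: r) :
    TM2.stepAux (o.code (B := B) l l') (st.1, none) (stks st.2) = config l (o.succ a r st) := by
  have h' : stks (B := B) st.2 (some o.src) = a :: r := h
  simp only [Op.code, TM2.stepAux, h', List.head?_cons, List.tail_cons, Option.isSome_some,
    cond_true]
  rw [update_stks, stepAux_pushCode]
  rfl

theorem stepAux_code_fail (o : Op K A σ) (l l' : Λ) (st : σ × (K → List A))
    (h : st.2 o.src = []) :
    TM2.stepAux (o.code (B := B) l l') (st.1, none) (stks st.2) = config l' (o.fail st) := by
  have h' : stks (B := B) st.2 (some o.src) = [] := h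
  simp only [Op.code, TM2.stepAux, h', List.head?_nil, List.tail_nil, Option.isSome_none,
    cond_false]
  rw [update_stks, update_eq_self_iff.2 h.symm]
  rfl

/-- The machine goes from `c` to `c'` in `n` steps. -/
def Steps (M : Λ → Code K A B Λ σ) (n : ℕ)
    (c c' : TM2.Cfg (Alphabet K A B) Λ (σ × Option A)) : Prop :=
  (flip bind (TM2.step M))^[n] (some c) = some c'

theorem Steps.trans {M : Λ → Code K A B Λ σ} {m n : ℕ}
    {c c' c'' : TM2.Cfg (Alphabet K A B) Λ (σ × Option A)} (h : Steps M m c c')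
    (h' : Steps M n c' c'') : Steps M (m + n) c c'' := by
  rw [Steps, add_comm, iterate_add_apply, h, h']

theorem steps_one {M : Λ → Code K A B Λ σ} {l : Λ} {st : σ × (K → List A)}
    {c' : TM2.Cfg (Alphabet K A B) Λ (σ × Option A)}
    (h : TM2.stepAux (M l) (st.1, none) (stks st.2) = c') : Steps M 1 (config l st) c' := by
  subst h; rfl

/-- The embedding `e` and the label `exit` are arbitrary because a subprogram runs inside the
machine of the whole program. The exit of a part is the entry of its successor, and that of a loop
body is the loop head, so no extra steps occur between parts. -/
theorem steps_code (M : Λ → Code K A B Λ σ) (p : Prog K A σ) (hp : p.WellFormed)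
    (e : p.Label → Λ) (exit : Λ) (h : ∀ l, M (e l) = p.code e exit l) (st : σ × (K → List A)) :
    Steps M (p.time st) (config (e p.entry) st) (config exit (p.eval st)) := by
  induction p generalizing exit st with
  | skip => exact steps_one (by rw [h]; rfl)
  | act o =>
    refine steps_one ?_
    rw [h, Prog.code, Prog.eval, Op.eval]
    split
    · next h' => exact stepAux_code_fail _ _ _ _ h'
    · next h' => exact stepAux_code_succ _ _ _ _ h'
  | seq p q ihp ihq =>
    exact (ihp hp.1 (fun x => e (.inl x)) (e (.inr q.entry)) (fun l => h (.inl l)) st).trans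
      (ihq hp.2 (fun x => e (.inr x)) exit (fun l => h (.inr l)) _)
  | loop o p ih =>
    rw [Prog.time, Prog.eval]
    generalize hl : st.2 o.src = l
    have h0 : M (e none) = o.code (e (some p.entry)) exit := h none
    induction l generalizing st with
    | nil => exact steps_one (by rw [Prog.entry, h0]; exact stepAux_code_fail _ _ _ _ hl)
    | cons a l ihl =>
      have h1 : Steps M 1 (config (e none) st) (config (e (some p.entry)) (o.succ a l st)) :=
        steps_one (by rw [h0]; exact stepAux_code_succ _ _ _ _ hl)
      exact (h1.trans (ih hp.2.2 (fun x => e (some x)) (e none) (fun l => h (some l)) _)).trans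
        (ihl _ (by rw [hp.2.1.eval, Op.succ_src hp.1]))
  | cond b p ih =>
    rw [Prog.time, Prog.eval]
    have h0 : M (e none) = .branch (fun v => b v.1) (.goto fun _ => e (some p.entry))
      (.goto fun _ => exit) := h none
    by_cases hb : b st.1 = true
    · rw [if_pos hb, if_pos hb]
      refine Steps.trans (c' := config (e (some p.entry)) st) (steps_one ?_)
        (ih hp (fun x => e (some x)) exit (fun l => h (some l)) _)
      rw [Prog.entry, h0]
      simp [TM2.stepAux, hb, config]
    · rw [if_neg hb, if_neg hb]
      refine steps_one ?_
      rw [Prog.entry, h0]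
      simp [TM2.stepAux, hb, config]

/-! ### Clean halting and polynomial-time computability -/

/-- Empty the given stacks. -/
def clear : List K → Prog K A σ
  | [] => .skip
  | k :: ks => .seq (.loop ⟨k, fun s _ => s, []⟩ .skip) (clear ks)

theorem wellFormed_clear (ks : List K) : (clear ks : Prog K A σ).WellFormed := by
  induction ks with
  | nil => trivial
  | cons k ks ih => exact ⟨⟨by simp, trivial, trivial⟩, ih⟩

theorem weighted_clear (w : K → ℕ) (ks : List K) :
    (clear ks : Prog K A σ).All (Op.Weighted w) := by
  induction ks with
  | nil => trivial
  | cons k ks ih => exact ⟨⟨Nat.zero_le _, trivial⟩, ih⟩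

theorem eval_clear_loop (k : K) (st : σ × (K → List A)) :
    (Prog.loop ⟨k, fun s _ => s, []⟩ .skip : Prog K A σ).eval st = (st.1, update st.2 k []) := by
  rw [Prog.eval]
  generalize hl : st.2 k = l
  induction l generalizing st with
  | nil => simp [evalLoop, Op.fail, ← hl]
  | cons a l ih =>
    rw [evalLoop, ih]
    · simp [Prog.eval, Op.succ, pushAll]
    · simp [Prog.eval, Op.succ, pushAll]

theorem eval_clear (ks : List K) (st : σ × (K → List A)) :
    (clear ks).eval st = (st.1, fun k => if k ∈ ks then [] else st.2 k) := by
  induction ks generalizing st with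
  | nil => simp [clear, Prog.eval]
  | cons k ks ih =>
    rw [clear, Prog.eval, eval_clear_loop, ih]
    refine Prod.ext rfl (funext fun j => ?_)
    by_cases h : j = k
    · subst h; simp
    · simp [h]

/-- A function that is computed by a program whose pushes are paid for by its pops is computable in
polynomial time. -/
theorem polyTime_of_prog [Fintype K] [Fintype A] [Fintype σ] {α β : Type} (ea : α → List A)
    (eb : β → List B) (f : α → β) (p : Prog K A σ) (hp : p.WellFormed) (w : K → ℕ)
    (hw : ∀ k, 1 ≤ w k) (h : p.All (Op.Weighted w)) (s : σ) (k : K) (out : σ → B)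
    (hf : ∀ a, eb (f a) = [out (p.eval (s, update (fun _ => []) k (ea a))).1]) :
    Nonempty (TM2ComputableInPolyTime ea eb f) := by
  classical
  -- A halting configuration must have all stacks empty except the output.
  let q : Prog K A σ := .seq p (clear Finset.univ.toList)
  have hq : q.WellFormed := ⟨hp, wellFormed_clear _⟩
  have hq' : q.All (Op.Weighted w) := ⟨h, weighted_clear _ _⟩
  let _ := q.fintypeLabel
  let M : Option q.Label → Code K A B (Option q.Label) σ
    -- One extra label writes the answer and restores the initial control state, as a halting
    -- configuration demands; it accounts for the `+ 1` in the time bound.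
    | none => .push none (fun v => out v.1) (.load (fun _ => (s, none)) .halt)
    | some l => q.code some none l
  let tm : FinTM2 :=
    { K := Option K
      k₀ := some k
      k₁ := none
      Γ := Alphabet K A B
      Λ := Option q.Label
      main := some q.entry
      σ := σ × Option A
      initialState := (s, none)
      Γk₀Fin := inferInstanceAs (Fintype A)
      m := M }
  refine ⟨⟨⟨tm, Equiv.refl A, Equiv.refl B⟩,
    (q.bound.comp (Polynomial.C (w k) * Polynomial.X)) + 1, fun a =>
    ⟨⟨q.time (s, update (fun _ => []) k (ea a)) + 1, ?_⟩, ?_⟩⟩⟩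
  · have h1 := steps_code M q hq some none (fun l => rfl) (s, update (fun _ => []) k (ea a))
    have h2 : Steps M 1 (config none (q.eval (s, update (fun _ => []) k (ea a)))) _ := steps_one rfl
    have h3 := h1.trans h2
    have e1 : initList tm (List.map (Equiv.refl A).invFun (ea a)) =
        config (some q.entry) (s, update (fun _ => []) k (ea a)) := by
      refine congrArg (TM2.Cfg.mk _ _) (funext fun j => ?_)
      cases j with
      | none => exact dif_neg (by simp [tm])
      | some j =>
        by_cases h : j = k
        · subst h
          refine (dif_pos rfl).trans ?_
          simp [stks]
        · refine (dif_neg (by simpa [tm] using h)).trans ?_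
          simp [stks, h]
    have e2 : haltList tm (List.map (Equiv.refl B).invFun (eb (f a))) =
        TM2.stepAux (M none) ((q.eval (s, update (fun _ => []) k (ea a))).1, none)
          (stks (q.eval (s, update (fun _ => []) k (ea a))).2) := by
      refine congrArg (TM2.Cfg.mk _ _) (funext fun j => ?_)
      have hq : q.eval (s, update (fun _ => []) k (ea a)) =
          ((p.eval (s, update (fun _ => []) k (ea a))).1, fun _ => []) := by
        simp [q, Prog.eval, eval_clear]
      cases j with
      | none =>
        refine (dif_pos rfl).trans ?_
        simp [hf, hq, stks]
      | some j =>
        refine (dif_neg (by simp [tm])).trans ?_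
        simp [hq, stks]
    rw [e1]
    exact Eq.trans h3 (congrArg some e2.symm)
  · have h1 := q.time_le hw hq hq' (s, update (fun _ => []) k (ea a))
    have h2 : size w (update (fun _ => []) k (ea a)) = w k * (ea a).length := by
      have := size_update w (fun _ : K => ([] : List A)) k (ea a)
      simpa [size] using this
    simp only [h2] at h1
    simpa using h1

end StackProgram

/-! ### The verifier -/

namespace EVC

namespace Verifier

open StackProgram Function

/-- The stacks of the verifier: the input; the binary digits of `k`; the adjacency matrix reversed,
still to be read, and already read; the certificate reversed and still to be read; tokens for
the vertices (three copies), for `k` and for the index of the current row; the current row. -/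
inductive Stack
  | inp | kb | xa | ar | al | ci | cs | fp | nn | m | m2 | u | u2 | d | d2 | r1 | r2 | s1 | s2
  deriving DecidableEq

instance : Fintype Stack where
  elems := {.inp, .kb, .xa, .ar, .al, .ci, .cs, .fp, .nn, .m, .m2, .u, .u2, .d, .d2, .r1, .r2, .s1, .s2}
  complete k := by cases k <;> simp

/-- The control state: the separator after `k` has been read; one row, or two rows, have been seen;
`k` exceeds the number of vertices; all checks were successful so far; two bits. -/
structure Regs where
  ph : Bool
  one : Bool
  two : Bool
  ovf : Bool
  ok : Bool
  c1 : Bool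
  c2 : Bool

noncomputable instance : Fintype Regs :=
  Fintype.ofInjective (fun s : Regs => (s.ph, s.one, s.two, s.ovf, s.ok, s.c1, s.c2)) <| by
    rintro ⟨⟩ ⟨⟩ h
    simpa using h

/-- The contents of the stacks. -/
structure Tapes where
  inp : List (Symbol ⊕ Symbol) := []
  kb : List (Symbol ⊕ Symbol) := []
  xa : List (Symbol ⊕ Symbol) := []
  ar : List (Symbol ⊕ Symbol) := []
  al : List (Symbol ⊕ Symbol) := []
  ci : List (Symbol ⊕ Symbol) := []
  cs : List (Symbol ⊕ Symbol) := []
  fp : List (Symbol ⊕ Symbol) := []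
  nn : List (Symbol ⊕ Symbol) := []
  m : List (Symbol ⊕ Symbol) := []
  m2 : List (Symbol ⊕ Symbol) := []
  u : List (Symbol ⊕ Symbol) := []
  u2 : List (Symbol ⊕ Symbol) := []
  d : List (Symbol ⊕ Symbol) := []
  d2 : List (Symbol ⊕ Symbol) := []
  r1 : List (Symbol ⊕ Symbol) := []
  r2 : List (Symbol ⊕ Symbol) := []
  s1 : List (Symbol ⊕ Symbol) := []
  s2 : List (Symbol ⊕ Symbol) := []

/-- The contents of the stacks as a function. -/
def Tapes.toFun (T : Tapes) : Stack → List (Symbol ⊕ Symbol)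
  | .inp => T.inp
  | .kb => T.kb
  | .xa => T.xa
  | .ar => T.ar
  | .al => T.al
  | .ci => T.ci
  | .cs => T.cs
  | .fp => T.fp
  | .nn => T.nn
  | .m => T.m
  | .m2 => T.m2
  | .u => T.u
  | .u2 => T.u2
  | .d => T.d
  | .d2 => T.d2
  | .r1 => T.r1
  | .r2 => T.r2
  | .s1 => T.s1
  | .s2 => T.s2

@[simp]
theorem update_inp (T : Tapes) (l : List (Symbol ⊕ Symbol)) :
    update T.toFun .inp l = Tapes.toFun { T with inp := l } := by
  funext k; cases k <;> rfl

@[simp]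
theorem update_kb (T : Tapes) (l : List (Symbol ⊕ Symbol)) :
    update T.toFun .kb l = Tapes.toFun { T with kb := l } := by
  funext k; cases k <;> rfl

@[simp]
theorem update_xa (T : Tapes) (l : List (Symbol ⊕ Symbol)) :
    update T.toFun .xa l = Tapes.toFun { T with xa := l } := by
  funext k; cases k <;> rfl

@[simp]
theorem update_ar (T : Tapes) (l : List (Symbol ⊕ Symbol)) :
    update T.toFun .ar l = Tapes.toFun { T with ar := l } := by
  funext k; cases k <;> rfl

@[simp]
theorem update_al (T : Tapes) (l : List (Symbol ⊕ Symbol)) :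
    update T.toFun .al l = Tapes.toFun { T with al := l } := by
  funext k; cases k <;> rfl

@[simp]
theorem update_ci (T : Tapes) (l : List (Symbol ⊕ Symbol)) :
    update T.toFun .ci l = Tapes.toFun { T with ci := l } := by
  funext k; cases k <;> rfl

@[simp]
theorem update_cs (T : Tapes) (l : List (Symbol ⊕ Symbol)) :
    update T.toFun .cs l = Tapes.toFun { T with cs := l } := by
  funext k; cases k <;> rfl

@[simp]
theorem update_fp (T : Tapes) (l : List (Symbol ⊕ Symbol)) :
    update T.toFun .fp l = Tapes.toFun { T with fp := l } := by
  funext k; cases k <;> rfl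

@[simp]
theorem update_nn (T : Tapes) (l : List (Symbol ⊕ Symbol)) :
    update T.toFun .nn l = Tapes.toFun { T with nn := l } := by
  funext k; cases k <;> rfl

@[simp]
theorem update_m (T : Tapes) (l : List (Symbol ⊕ Symbol)) :
    update T.toFun .m l = Tapes.toFun { T with m := l } := by
  funext k; cases k <;> rfl

@[simp]
theorem update_m2 (T : Tapes) (l : List (Symbol ⊕ Symbol)) :
    update T.toFun .m2 l = Tapes.toFun { T with m2 := l } := by
  funext k; cases k <;> rfl

@[simp]
theorem update_u (T : Tapes) (l : List (Symbol ⊕ Symbol)) :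
    update T.toFun .u l = Tapes.toFun { T with u := l } := by
  funext k; cases k <;> rfl

@[simp]
theorem update_u2 (T : Tapes) (l : List (Symbol ⊕ Symbol)) :
    update T.toFun .u2 l = Tapes.toFun { T with u2 := l } := by
  funext k; cases k <;> rfl

@[simp]
theorem update_d (T : Tapes) (l : List (Symbol ⊕ Symbol)) :
    update T.toFun .d l = Tapes.toFun { T with d := l } := by
  funext k; cases k <;> rfl

@[simp]
theorem update_d2 (T : Tapes) (l : List (Symbol ⊕ Symbol)) :
    update T.toFun .d2 l = Tapes.toFun { T with d2 := l } := by
  funext k; cases k <;> rfl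

@[simp]
theorem update_r1 (T : Tapes) (l : List (Symbol ⊕ Symbol)) :
    update T.toFun .r1 l = Tapes.toFun { T with r1 := l } := by
  funext k; cases k <;> rfl

@[simp]
theorem update_r2 (T : Tapes) (l : List (Symbol ⊕ Symbol)) :
    update T.toFun .r2 l = Tapes.toFun { T with r2 := l } := by
  funext k; cases k <;> rfl

@[simp]
theorem update_s1 (T : Tapes) (l : List (Symbol ⊕ Symbol)) :
    update T.toFun .s1 l = Tapes.toFun { T with s1 := l } := by
  funext k; cases k <;> rfl

@[simp]
theorem update_s2 (T : Tapes) (l : List (Symbol ⊕ Symbol)) :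
    update T.toFun .s2 l = Tapes.toFun { T with s2 := l } := by
  funext k; cases k <;> rfl

/-! ### The program of the verifier -/

/-- Programs of the verifier. -/
abbrev Program : Type := Prog Stack (Symbol ⊕ Symbol) Regs

/-- A bit as a stack symbol. -/
def bit (b : Bool) : Symbol ⊕ Symbol := Sum.inl (some b)

/-- The separator as a stack symbol. It also serves as a token. -/
def sep : Symbol ⊕ Symbol := Sum.inl none

/-- Whether a symbol is a bit. -/
def isBit : Symbol ⊕ Symbol → Bool
  | .inl x => x.isSome
  | .inr x => x.isSome

/-- Whether a symbol has been popped that is the bit `1`. -/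
def isOne (x : Option (Symbol ⊕ Symbol)) : Bool := x == some (bit true)

@[simp]
theorem isOne_bit (b : Bool) : isOne (some (bit b)) = b := by cases b <;> rfl

@[simp]
theorem isOne_none : isOne none = false := rfl

/-- Push the popped symbol on the stack `k`. -/
def onto (k : Stack) : Stack × (Regs → Symbol ⊕ Symbol → Option (Symbol ⊕ Symbol)) :=
  (k, fun _ a => some a)

/-- Move the contents of a stack to another stack. -/
def move (k l : Stack) : Program := .loop ⟨k, fun s _ => s, [onto l]⟩ .skip

/-- The update of the control state in `parse`. -/
def parseUpd (s : Regs) : Option (Symbol ⊕ Symbol) → Regs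
  | some (.inl none) => if s.ph then { s with one := true, two := s.two || s.one }
      else { s with ph := true }
  | _ => s

/-- Distribute the input among the stacks. -/
def parse : Program := .loop ⟨.inp, parseUpd,
  [(.kb, fun s a => if s.ph then none else match a with
      | .inl (some b) => some (bit b)
      | _ => none),
    -- Only the separator after `k` is read with `ph` unset; it supplies the one that marks the
    -- diagonal.
    (.d, fun s a => if s.ph || decide (a ≠ sep) then none else some (bit true)),
    (.xa, fun s a => match a with
      | .inl x => if s.ph then some (.inl x) else none
      | _ => none),
    (.fp, fun s a => if s.ph && decide (a = sep) then some sep else none),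
    (.nn, fun s a => if s.ph && decide (a = sep) then some sep else none),
    (.m, fun s a => if s.ph && decide (a = sep) then some sep else none),
    (.ci, fun _ a => match a with
      | .inr x => some (.inl x)
      | _ => none)]⟩ .skip

/-- Compare the adjacency matrix and the certificate symbol by symbol. -/
def shapeLoop : Program :=
  .loop ⟨.xa, fun s x => { s with c1 := x.elim false isBit }, [onto .ar]⟩ <|
    .act ⟨.ci, fun s x => { s with ok := s.ok && x.elim false fun a => isBit a == s.c1 },
      [onto .cs]⟩

/-- Check that the certificate has the shape of the adjacency matrix. -/
def shape : Program :=
  .seq shapeLoop (.act ⟨.ci, fun s x => { s with ok := s.ok && x.isNone }, []⟩)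

/-- Double the number of tokens on `u`, moving them to `u2`. -/
def double : Program :=
  .loop ⟨.u, fun s _ => s, [onto .u2]⟩ <|
    .act ⟨.fp, fun s x => { s with ovf := s.ovf || x.isNone }, [onto .u2]⟩

/-- Convert `k` to unary, with as many tokens as there are vertices at disposal. -/
def unary : Program :=
  .loop ⟨.kb, fun s x => { s with c1 := isOne x }, []⟩ <|
    .seq double <| .seq
      (.cond (fun s => s.c1)
        (.act ⟨.fp, fun s x => { s with ovf := s.ovf || x.isNone }, [onto .u2]⟩))
      (move .u2 .u)

/-- Read a row of the certificate, check its entry on the diagonal and count its ones. -/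
def readRow : Program :=
  -- The failing pop at the end of the loop resets `c1`; within a round `c1` is overwritten anyway.
  .loop ⟨.m, fun s x => { s with c1 := x.isSome && s.c1 }, [onto .m2]⟩ <|
    .seq (.act ⟨.cs, fun s x => { s with c1 := isOne x }, [onto .r1, onto .r2]⟩) <|
    .seq (.act ⟨.d, fun s x => { s with ok := s.ok && (!isOne x || s.c1) }, [onto .d2]⟩)
      (.cond (fun s => s.c1)
        (.act ⟨.u, fun s x => { s with ok := s.ok && x.isSome }, [onto .u2]⟩))

/-- Check that the current row covers the edges at one vertex. -/
def coverRow : Program :=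
  .loop ⟨.s2, fun s x => { s with c2 := isOne x }, [onto .r2]⟩ <|
    .act ⟨.ar, fun s x => { s with ok := s.ok && (!isOne x || s.c1 || s.c2) },
      [onto .al]⟩

/-- Check that the current row is a vertex cover. -/
def cover : Program :=
  .loop ⟨.s1, fun s x => { s with c1 := isOne x }, []⟩ <|
    .seq coverRow <| .seq (.act ⟨.ar, fun s _ => s, [onto .al]⟩) (move .r2 .s2)

/-- Read and check a row of the certificate. -/
def row : Program :=
  .seq readRow <|
  -- `readRow` ensures at most `k` ones; a token left over here means fewer than `k`.
  .seq (.act ⟨.u, fun s x => { s with ok := s.ok && x.isNone }, [onto .u2]⟩) <|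
  .seq (move .u2 .u) <| .seq (move .d2 .d) <| .seq (move .m2 .m) <|
  -- The separator of the row becomes a zero on `d`, which shifts the diagonal marker to the next
  -- column.
  .seq (.act ⟨.cs, fun s _ => s, [(.d, fun _ _ => some (bit false))]⟩) <|
  .seq (move .r1 .s1) <| .seq (move .r2 .s2) <| .seq cover <| .seq (move .al .ar)
  (.loop ⟨.s2, fun s _ => s, []⟩ .skip)

/-- Check all rows of the certificate. -/
def rows : Program := .loop ⟨.nn, fun s _ => s, []⟩ row

/-- The program of the verifier. -/
def program : Program := .seq parse <| .seq shape <| .seq unary rows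

/-- The initial control state. -/
def start : Regs := ⟨false, false, false, false, true, false, false⟩

/-- Weights for which no operation increases the weighted number of symbols. -/
def weight : Stack → ℕ
  -- One input symbol may pay for all pushes of `parse`: six of weight 1 and one on `ci`. A
  -- certificate symbol weighs 2 since `readRow` copies it to both `r1` and `r2`.
  | .inp => 8
  | .cs => 2
  | .ci => 2
  | _ => 1

theorem wellFormed_program : program.WellFormed := by
  simp [program, parse, shape, shapeLoop, unary, double, rows, row, readRow, coverRow, cover, move,
    onto, Prog.WellFormed, Prog.Avoids, Op.Avoids]

theorem weighted_program : program.All (Op.Weighted weight) := by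
  simp [program, parse, shape, shapeLoop, unary, double, rows, row, readRow, coverRow, cover, move,
    onto, Prog.All, Op.Weighted, weight]

/-! ### Monotone flags -/

/-- The flags that matter at the end can change in one direction only. -/
def Regs.Le (s t : Regs) : Prop :=
  (s.ovf = true → t.ovf = true) ∧ (s.ok = false → t.ok = false)

theorem Regs.Le.refl (s : Regs) : s.Le s := ⟨id, id⟩

theorem Regs.Le.trans (s t u : Regs) (h : s.Le t) (h' : t.Le u) : s.Le u :=
  ⟨fun x => h'.1 (h.1 x), fun x => h'.2 (h.2 x)⟩

/-- Once a check has failed or the pool has run dry, the outcome of that flag is settled and the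
rest of the run need not be computed. -/
theorem le_eval {p : Program} (h : p.All fun o => ∀ (s : Regs) x, s.Le (o.upd s x))
    (st : Regs × (Stack → List (Symbol ⊕ Symbol))) : st.1.Le (p.eval st).1 :=
  h.eval_rel Regs.Le.refl Regs.Le.trans st

theorem le_unary (st : Regs × (Stack → List (Symbol ⊕ Symbol))) : st.1.Le (unary.eval st).1 := by
  refine le_eval ?_ _
  simp +contextual [unary, double, Prog.All, Regs.Le, move]

theorem le_rows (st : Regs × (Stack → List (Symbol ⊕ Symbol))) : st.1.Le (rows.eval st).1 := by
  refine le_eval ?_ _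
  simp +contextual [rows, row, readRow, coverRow, cover, Prog.All, Regs.Le, move]

theorem eval_act_nil {o : Op Stack (Symbol ⊕ Symbol) Regs} {s : Regs} {T : Tapes}
    (h : T.toFun o.src = []) : (Prog.act o).eval (s, T.toFun) = (o.upd s none, T.toFun) := by
  simp [Prog.eval, Op.eval, h, Op.fail]

theorem eval_act_cons {o : Op Stack (Symbol ⊕ Symbol) Regs} {s : Regs} {T : Tapes}
    {a : Symbol ⊕ Symbol} {l : List (Symbol ⊕ Symbol)}
    (h : T.toFun o.src = a :: l) : (Prog.act o).eval (s, T.toFun) = o.succ a l (s, T.toFun) := by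
  simp [Prog.eval, Op.eval, h]

theorem two_eval_rest (st : Regs × (Stack → List (Symbol ⊕ Symbol))) :
    ((Prog.seq shape <| .seq unary rows).eval st).1.two = st.1.two := by
  refine Prog.All.eval_rel (R := fun s t : Regs => t.two = s.two) (fun _ => rfl)
    (fun _ _ _ h h' => h'.trans h) ?_ st
  simp [shape, shapeLoop, unary, double, rows, row, readRow, coverRow, cover, move, Prog.All]

theorem eval_move_aux {k l : Stack} (hkl : k ≠ l) (s : Regs) (S : Stack → List (Symbol ⊕ Symbol)) :
    (move k l).eval (s, S) = (s, update (update S k []) l ((S k).reverse ++ S l)) := by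
  generalize h : S k = r
  induction r generalizing S with
  | nil =>
    rw [move, Prog.eval_loop_nil h, Op.fail]
    refine Prod.ext rfl (funext fun j => ?_)
    by_cases h1 : j = l
    · subst h1; simp
    · by_cases h2 : j = k
      · subst h2; simp [hkl, h]
      · simp [h1, h2]
  | cons a r ih =>
    rw [move, Prog.eval_loop_cons (by
      simpa [onto, Prog.WellFormed, Prog.Avoids] using hkl.symm) h, ← move]
    simp only [Prog.eval, Op.succ, onto, pushAll, Option.toList_some]
    rw [ih _ (by simp [hkl])]
    refine Prod.ext rfl (funext fun j => ?_)
    by_cases h1 : j = l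
    · subst h1; simp [hkl.symm]
    · by_cases h2 : j = k
      · subst h2; simp [hkl]
      · simp [h1, h2]

theorem eval_move {k l : Stack} (hkl : k ≠ l) (s : Regs) (T : Tapes) :
    (move k l).eval (s, T.toFun) =
      (s, update (update T.toFun k []) l ((T.toFun k).reverse ++ T.toFun l)) :=
  eval_move_aux hkl s T.toFun

/-! ### Evaluation of the checks on rows -/

/-- A list of bits as a list of stack symbols. -/
def bits (l : List Bool) : List (Symbol ⊕ Symbol) := l.map bit

@[simp] theorem bits_nil : bits [] = [] := rfl

@[simp] theorem bits_cons (b : Bool) (l : List Bool) : bits (b :: l) = bit b :: bits l := rfl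

@[simp] theorem bits_append (l l' : List Bool) : bits (l ++ l') = bits l ++ bits l' :=
  List.map_append

@[simp] theorem reverse_bits (l : List Bool) : (bits l).reverse = bits l.reverse :=
  List.map_reverse.symm

@[simp] theorem bit_inj {a b : Bool} : bit a = bit b ↔ a = b := by simp [bit]

/-- The edges given by the first list have an end in the set given by `c` and the second list. -/
def coverRowOK (c : Bool) : List Bool → List Bool → Bool
  | a :: as, b :: bs => (!a || c || b) && coverRowOK c as bs
  | _, _ => true

theorem eval_coverRow (l as : List Bool) (hl : as.length = l.length) (s : Regs) (T : Tapes)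
    (rest : List (Symbol ⊕ Symbol)) (h2 : T.s2 = bits l) (ha : T.ar = bits as ++ rest) :
    coverRow.eval (s, T.toFun) = ({ s with ok := s.ok && coverRowOK s.c1 as l, c2 := false },
      Tapes.toFun { T with s2 := [], ar := rest, al := bits as.reverse ++ T.al,
                           r2 := bits l.reverse ++ T.r2 }) := by
  induction l generalizing s T as with
  | nil =>
    obtain rfl := List.length_eq_zero_iff.1 hl
    rw [coverRow, Prog.eval_loop_nil (by simpa [Tapes.toFun] using h2)]
    cases T
    simp_all [Op.fail, coverRowOK]
  | cons b l ih =>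
    obtain _ | ⟨a, as⟩ := as
    · simp at hl
    rw [coverRow, Prog.eval_loop_cons (by simp [Prog.WellFormed, Prog.Avoids, Op.Avoids, onto]) h2,
      ← coverRow]
    simp only [Op.succ, onto, pushAll, update_s2, update_r2, Option.toList_some]
    rw [eval_act_cons (a := bit a) (l := bits as ++ rest) (by simp [Tapes.toFun, ha])]
    simp only [Op.succ, pushAll, update_ar, update_al, Option.toList_some]
    rw [ih as (by simpa using hl) _ _ rfl rfl]
    simp [Tapes.toFun, coverRowOK, Bool.and_assoc]

/-- A list of rows as a list of stack symbols. -/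
def flat (L : List (List Bool)) : List (Symbol ⊕ Symbol) := L.flatMap fun l => bits l ++ [sep]

@[simp] theorem flat_nil : flat [] = [] := rfl

@[simp] theorem flat_cons (l : List Bool) (L : List (List Bool)) :
    flat (l :: L) = bits l ++ sep :: flat L := by simp [flat]

/-- The set given by the first and the third list covers the edges given by the rows. -/
def coverOK : List Bool → List (List Bool) → List Bool → Bool
  | b :: r, as :: L, l => coverRowOK b as l && coverOK r L l
  | _, _, _ => true

/-- The row on `s2` is reversed onto `r2` and then back, so every round meets it intact; this is why
`r2` has to be empty at the start. -/
theorem eval_cover (r : List Bool) (L : List (List Bool)) (l : List Bool)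
    (hr : r.length = L.length) (hL : ∀ as ∈ L, as.length = l.length) (s : Regs) (hs : s.c2 = false)
    (T : Tapes) (rest : List (Symbol ⊕ Symbol)) (h1 : T.s1 = bits r) (h2 : T.s2 = bits l)
    (hr2 : T.r2 = []) (ha : T.ar = flat L ++ rest) :
    cover.eval (s, T.toFun) = ({ s with ok := s.ok && coverOK r L l, c1 := false },
      Tapes.toFun { T with s1 := [], ar := rest, al := (flat L).reverse ++ T.al }) := by
  induction r generalizing s T L with
  | nil =>
    obtain rfl := List.length_eq_zero_iff.1 hr.symm
    rw [cover, Prog.eval_loop_nil (by simpa [Tapes.toFun] using h1)]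
    cases T
    simp_all [Op.fail, coverOK]
  | cons b r ih =>
    obtain _ | ⟨as, L⟩ := L
    · simp at hr
    rw [cover, Prog.eval_loop_cons (by
      simp [Prog.WellFormed, Prog.Avoids, Op.Avoids, onto, coverRow, move]) h1, ← cover]
    simp only [Op.succ, pushAll, update_s1]
    simp only [Prog.eval_seq]
    rw [eval_coverRow l as (hL as List.mem_cons_self) _ _ (sep :: flat L ++ rest) (by simp [h2])
      (by simp [ha])]
    rw [eval_act_cons (a := sep) (l := flat L ++ rest) (by simp [Tapes.toFun])]
    simp only [Op.succ, onto, pushAll, update_ar, update_al, Option.toList_some]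
    rw [eval_move (by simp)]
    simp only [update_r2, update_s2]
    rw [ih L (by simpa using hr) (fun as h => hL as (List.mem_cons_of_mem _ h)) _ rfl _ rfl
      (by simp [Tapes.toFun, hr2]) rfl rfl]
    cases s
    simp_all [Tapes.toFun, coverOK, Bool.and_assoc]

/-- The row has a one wherever the first list has a one. -/
def diagOK : List (Symbol ⊕ Symbol) → List Bool → Bool
  | x :: D, b :: r => (!isOne (some x) || b) && diagOK D r
  | _, _ => true

/-- Each one in the row moves a token from `u` to `u2`, and a missing token clears `ok`. Truncated
subtraction and `min` cover the case in which tokens run out. -/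
theorem eval_readRow (r : List Bool) (ms : List (Symbol ⊕ Symbol)) (hm : ms.length = r.length)
    (D : List (Symbol ⊕ Symbol)) (j i : ℕ) (s : Regs) (T : Tapes)
    (rest : List (Symbol ⊕ Symbol)) (h1 : T.m = ms) (h2 : T.cs = bits r ++ rest)
    (hd : T.d = D) (hu : T.u = List.replicate j sep) (hi : T.u2 = List.replicate i sep) :
    readRow.eval (s, T.toFun) = ({ s with
        ok := s.ok && (diagOK D r && decide (r.count true ≤ j)), c1 := false },
      Tapes.toFun { T with
        m := [], m2 := ms.reverse ++ T.m2, cs := rest,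
        r1 := bits r.reverse ++ T.r1, r2 := bits r.reverse ++ T.r2,
        d := D.drop r.length, d2 := (D.take r.length).reverse ++ T.d2,
        u := List.replicate (j - r.count true) sep,
        u2 := List.replicate (i + min j (r.count true)) sep }) := by
  induction r generalizing s T ms D j i with
  | nil =>
    obtain rfl := List.length_eq_zero_iff.1 hm
    rw [readRow, Prog.eval_loop_nil (by simpa [Tapes.toFun] using h1)]
    cases T
    simp_all [Op.fail, diagOK]
  | cons b r ih =>
    obtain _ | ⟨t, ms⟩ := ms
    · simp at hm
    rw [readRow, Prog.eval_loop_cons (by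
      simp [Prog.WellFormed, Prog.Avoids, Op.Avoids, onto]) h1, ← readRow]
    simp only [Op.succ, onto, pushAll, update_m, update_m2, Option.toList_some]
    simp only [Prog.eval_seq]
    rw [eval_act_cons (a := bit b) (l := bits r ++ rest) (by simp [Tapes.toFun, h2])]
    simp only [Op.succ, pushAll, update_cs, update_r1, update_r2, Option.toList_some, isOne_bit]
    obtain _ | ⟨x, D⟩ := D
    · rw [eval_act_nil (by simp [Tapes.toFun, hd])]
      obtain _ | b := b
      · rw [Prog.eval_cond, if_neg (by simp), ih ms (by simpa using hm) [] j i _ _ rfl rfl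
          (by simp [hd]) (by simp [hu]) (by simp [hi])]
        simp [Tapes.toFun, diagOK]
      · obtain _ | j := j
        · rw [Prog.eval_cond, if_pos (by simp), eval_act_nil (by simp [Tapes.toFun, hu]),
            ih ms (by simpa using hm) [] 0 i _ _ rfl rfl
            (by simp [hd]) (by simp [hu]) (by simp [hi])]
          simp [Tapes.toFun, diagOK]
        · rw [Prog.eval_cond, if_pos (by simp), eval_act_cons (a := sep) (l := List.replicate j sep)
              (by simp [Tapes.toFun, hu, List.replicate_succ])]
          simp only [Op.succ, pushAll, update_u, update_u2, Option.toList_some]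
          rw [ih ms (by simpa using hm) [] j (i + 1) _ _ rfl rfl
            (by simp [hd]) rfl (by simp [Tapes.toFun, hi, List.replicate_succ])]
          simp [Tapes.toFun, diagOK, Nat.add_min_add_right, Nat.add_sub_add_right]
          ring_nf
    · rw [eval_act_cons (a := x) (l := D) (by simp [Tapes.toFun, hd])]
      simp only [Op.succ, pushAll, update_d, update_d2, Option.toList_some]
      obtain _ | b := b
      · rw [Prog.eval_cond, if_neg (by simp), ih ms (by simpa using hm) D j i _ _ rfl rfl
          rfl (by simp [hu]) (by simp [hi])]
        simp [Tapes.toFun, diagOK, Bool.and_assoc]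
      · obtain _ | j := j
        · rw [Prog.eval_cond, if_pos (by simp), eval_act_nil (by simp [Tapes.toFun, hu]),
            ih ms (by simpa using hm) D 0 i _ _ rfl rfl
            rfl (by simp [hu]) (by simp [hi])]
          simp [Tapes.toFun, diagOK]
        · rw [Prog.eval_cond, if_pos (by simp), eval_act_cons (a := sep) (l := List.replicate j sep)
              (by simp [Tapes.toFun, hu, List.replicate_succ])]
          simp only [Op.succ, pushAll, update_u, update_u2, Option.toList_some]
          rw [ih ms (by simpa using hm) D j (i + 1) _ _ rfl rfl
            rfl rfl (by simp [Tapes.toFun, hi, List.replicate_succ])]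
          simp [Tapes.toFun, diagOK, Nat.add_min_add_right, Nat.add_sub_add_right]
          ring_nf

/-- The row `r` with index `v` passes all checks. -/
def rowOK (L : List (List Bool)) (k v : ℕ) (r : List Bool) : Bool :=
  diagOK (List.replicate v (bit false) ++ [bit true]) r && decide (r.count true = k) &&
    coverOK r L r

/-- The stacks while the rows are read. -/
def Tapes.Ready (T : Tapes) (L : List (List Bool)) (k v : ℕ) : Prop :=
  T.m = List.replicate L.length sep ∧ T.m2 = [] ∧ T.u = List.replicate k sep ∧ T.u2 = [] ∧
    T.d = List.replicate v (bit false) ++ [bit true] ∧ T.d2 = [] ∧ T.ar = flat L ∧ T.al = [] ∧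
    T.r1 = [] ∧ T.r2 = [] ∧ T.s1 = [] ∧ T.s2 = []

theorem eval_row (L : List (List Bool)) (hL : ∀ as ∈ L, as.length = L.length) (k v : ℕ)
    (hv : v < L.length) (r : List Bool) (hr : r.length = L.length) (s : Regs)
    (h1 : s.c1 = false) (h2 : s.c2 = false) (T : Tapes) (hT : T.Ready L k v)
    (rest : List (Symbol ⊕ Symbol)) (hc : T.cs = bits r ++ sep :: rest) :
    row.eval (s, T.toFun) = ({ s with ok := s.ok && rowOK L k v r },
      Tapes.toFun { T with cs := rest, d := bit false :: T.d }) := by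
  obtain ⟨hm, hm2, hu, hu2, hd, hd2, ha, hal, hr1, hr2, hs1, hs2⟩ := hT
  -- The diagonal marker is within the row, so `d` is consumed completely.
  have hdl : T.d.length ≤ r.length := by simp [hd]; omega
  rw [row]
  simp only [Prog.eval_seq]
  rw [eval_readRow r (List.replicate L.length sep) (by simp [hr]) T.d k 0 s T
    (sep :: rest) hm hc rfl hu hu2]
  rw [List.drop_of_length_le hdl, List.take_of_length_le hdl]
  -- The rest of the work on this row is the same whether or not a token was left on `u`; it matters
  -- only that `u` and `u2` together hold `k` tokens.
  have key : ∀ (s' : Regs) (u u2 : List (Symbol ⊕ Symbol)), s'.c1 = false → s'.c2 = false →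
      u.reverse ++ u2 = List.replicate k sep →
      (Prog.loop ⟨.s2, fun s _ => s, []⟩ .skip).eval ((move .al .ar).eval (cover.eval
        ((move .r2 .s2).eval ((move .r1 .s1).eval
        ((Prog.act ⟨.cs, fun s _ => s, [(.d, fun _ _ => some (bit false))]⟩ : Program).eval
        ((move .m2 .m).eval ((move .d2 .d).eval ((move .u2 .u).eval
        (s', Tapes.toFun { T with
          m := [], m2 := (List.replicate L.length sep).reverse ++ T.m2, cs := sep :: rest,
          r1 := bits r.reverse ++ T.r1, r2 := bits r.reverse ++ T.r2,
          d := [], d2 := T.d.reverse ++ T.d2, u := u2, u2 := u }))))))))) =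
        ({ s' with ok := s'.ok && coverOK r L r },
          Tapes.toFun { T with cs := rest, d := bit false :: T.d }) := by
    intro s' u u2 h1' h2' huu
    rw [eval_move (by simp)]
    simp only [update_u2, update_u]
    rw [eval_move (by simp)]
    simp only [update_d2, update_d]
    rw [eval_move (by simp)]
    simp only [update_m2, update_m]
    rw [eval_act_cons (a := sep) (l := rest) rfl]
    simp only [Op.succ, pushAll, update_cs, update_d, Option.toList_some]
    rw [eval_move (by simp)]
    simp only [update_r1, update_s1]
    rw [eval_move (by simp)]
    simp only [update_r2, update_s2]
    rw [eval_cover r L r hr (by simpa [hr] using hL) s' h2' _ []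
      (by simp [Tapes.toFun, hr1, hs1]) (by simp [Tapes.toFun, hr2, hs2]) rfl (by simp [ha])]
    rw [eval_move (by simp), eval_clear_loop]
    simp only [update_al, update_ar, update_s2]
    cases s'
    cases T
    simp_all [Tapes.toFun]
  by_cases hkr : r.count true < k
  · obtain ⟨j, hj⟩ : ∃ j, k - r.count true = j + 1 := ⟨k - r.count true - 1, by omega⟩
    rw [hj, eval_act_cons (a := sep) (l := List.replicate j sep)
      (by simp [Tapes.toFun, List.replicate_succ])]
    simp only [Op.succ, onto, pushAll, update_u, update_u2, Option.toList_some]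
    rw [key]
    · cases s
      simp_all [rowOK, ne_of_lt hkr]
    · rfl
    · exact h2
    · simp [Tapes.toFun, ← List.replicate_succ]
      omega
  · rw [eval_act_nil (by simp [Tapes.toFun]; omega)]
    rw [key]
    · cases s
      have : (decide (r.count true ≤ k)) = decide (r.count true = k) := by
        rw [decide_eq_decide]; omega
      simp_all [rowOK, Bool.and_assoc]
    · rfl
    · exact h2
    · simp
      omega

/-- All rows, the first of which has index `v`, pass all checks. -/
def rowsOK (L : List (List Bool)) (k : ℕ) : ℕ → List (List Bool) → Bool
  | _, [] => true
  | v, r :: R => rowOK L k v r && rowsOK L k (v + 1) R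

theorem ok_rows (L : List (List Bool)) (hL : ∀ as ∈ L, as.length = L.length) (k v : ℕ)
    (R : List (List Bool)) (hR : ∀ r ∈ R, r.length = L.length) (hv : v + R.length ≤ L.length)
    (s : Regs) (h1 : s.c1 = false) (h2 : s.c2 = false) (T : Tapes) (hT : T.Ready L k v)
    (hc : T.cs = flat R) (hn : T.nn = List.replicate R.length sep) :
    (rows.eval (s, T.toFun)).1 = { s with ok := s.ok && rowsOK L k v R } := by
  induction R generalizing s T v with
  | nil =>
    rw [rows, Prog.eval_loop_nil (by simpa [Tapes.toFun, List.replicate_succ] using hn)]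
    simp [Op.fail, rowsOK]
  | cons r R ih =>
    rw [rows, Prog.eval_loop_cons (a := sep) (l := List.replicate R.length sep) (by
      simp [row, readRow, coverRow, cover, move, onto, Prog.WellFormed, Prog.Avoids, Op.Avoids])
      (by simpa [Tapes.toFun, List.replicate_succ] using hn), ← rows]
    simp only [Op.succ, pushAll, update_nn]
    rw [eval_row L hL k v (by simp at hv; omega) r (hR r List.mem_cons_self) s h1 h2
      { T with nn := List.replicate R.length sep } hT (flat R) (by simp [hc]),
      ih (v + 1) (fun r h => hR r (List.mem_cons_of_mem _ h))
      (by simp at hv; omega)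
      { s with ok := s.ok && rowOK L k v r } h1 h2 _ ?_ rfl rfl]
    · simp [rowsOK, Bool.and_assoc]
    · obtain ⟨hm, hm2, hu, hu2, hd, hd2, ha, hal, hr1, hr2, hs1, hs2⟩ := hT
      exact ⟨hm, hm2, hu, hu2, by simp [hd, List.replicate_succ], hd2, ha, hal, hr1, hr2, hs1, hs2⟩

/-! ### Conversion of `k` from binary to unary -/

theorem wellFormed_double : double.WellFormed := by
  simp [double, onto, Prog.WellFormed, Prog.Avoids, Op.Avoids]

theorem le_double (st : Regs × (Stack → List (Symbol ⊕ Symbol))) :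
    st.1.Le (double.eval st).1 := by
  refine le_eval ?_ _
  simp +contextual [double, Prog.All, Regs.Le]

theorem eval_double (j i f : ℕ) (hj : j ≤ f) (s : Regs) (T : Tapes)
    (hu : T.u = List.replicate j sep) (hf : T.fp = List.replicate f sep)
    (hi : T.u2 = List.replicate i sep) :
    double.eval (s, T.toFun) = (s, Tapes.toFun { T with
      u := [], fp := List.replicate (f - j) sep, u2 := List.replicate (i + 2 * j) sep }) := by
  induction j generalizing i f T with
  | zero =>
    rw [double, Prog.eval_loop_nil (by simpa [Tapes.toFun, List.replicate_succ] using hu)]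
    cases T
    simp_all [Op.fail]
  | succ j ih =>
    obtain ⟨f, rfl⟩ : ∃ e, f = e + 1 := ⟨f - 1, by omega⟩
    rw [double, Prog.eval_loop_cons (a := sep) (l := List.replicate j sep) wellFormed_double
      (by simpa [Tapes.toFun, List.replicate_succ] using hu), ← double]
    simp only [Op.succ, onto, pushAll, update_u, update_u2, Option.toList_some]
    rw [eval_act_cons (a := sep) (l := List.replicate f sep)
        (by simpa [Tapes.toFun, List.replicate_succ] using hf)]
    simp only [Op.succ, pushAll, update_fp, update_u2, Option.toList_some, Option.isNone_some,
      Bool.or_false]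
    rw [ih (i + 2) f (by omega) _ rfl rfl (by simp [Tapes.toFun, hi, List.replicate_succ])]
    simp [mul_add]
    congr 3
    ring_nf

theorem ovf_double (j f : ℕ) (hj : f < j) (s : Regs) (T : Tapes)
    (hu : T.u = List.replicate j sep) (hf : T.fp = List.replicate f sep) :
    (double.eval (s, T.toFun)).1.ovf = true := by
  induction j generalizing f s T with
  | zero => omega
  | succ j ih =>
    rw [double, Prog.eval_loop_cons (a := sep) (l := List.replicate j sep) wellFormed_double
      (by simpa [Tapes.toFun, List.replicate_succ] using hu), ← double]
    simp only [Op.succ, onto, pushAll, update_u, update_u2, Option.toList_some]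
    obtain _ | f := f
    · rw [eval_act_nil (by simpa [Tapes.toFun, List.replicate_succ] using hf)]
      exact (le_double _).1 (by simp)
    · rw [eval_act_cons (a := sep) (l := List.replicate f sep)
        (by simpa [Tapes.toFun, List.replicate_succ] using hf)]
      simp only [Op.succ, pushAll, update_fp, update_u2, Option.toList_some]
      exact ih f (by omega) _ _ rfl rfl

/-- The number with the given binary digits, the most significant one first, preceded by `j`. -/
def value (j : ℕ) (l : List Bool) : ℕ := l.foldl (fun n b => 2 * n + b.toNat) j

theorem le_value (j : ℕ) (l : List Bool) : j ≤ value j l := by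
  induction l generalizing j with
  | nil => exact le_rfl
  | cons b l ih => exact le_trans (by omega) (ih (2 * j + b.toNat))

theorem wellFormed_unary : unary.WellFormed := by
  simp [unary, double, move, onto, Prog.WellFormed, Prog.Avoids, Op.Avoids]

/-- This is Horner's scheme: `u` holds the value of the digits read so far, and every new token
comes from `fp`, so that the total `f + j` is invariant. -/
theorem eval_unary (l : List Bool) (j f : ℕ) (s : Regs) (T : Tapes)
    (hl : T.kb = bits l) (hu : T.u = List.replicate j sep) (hf : T.fp = List.replicate f sep)
    (hu2 : T.u2 = []) (h : value j l ≤ f + j) :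
    unary.eval (s, T.toFun) = ({ s with c1 := false }, Tapes.toFun { T with
      kb := [], u := List.replicate (value j l) sep,
      fp := List.replicate (f + j - value j l) sep }) := by
  induction l generalizing j f s T with
  | nil =>
    rw [unary, Prog.eval_loop_nil (by simpa [Tapes.toFun] using hl)]
    cases T
    cases s
    simp_all [Op.fail, value]
  | cons b l ih =>
    -- Intermediate values never exceed the final one, so the pool suffices at this step too.
    have hv : 2 * j + b.toNat ≤ value j (b :: l) := le_value _ l
    rw [unary, Prog.eval_loop_cons (a := bit b) (l := bits l) wellFormed_unary hl, ← unary]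
    simp only [Op.succ, pushAll, update_kb, Prog.eval_seq, isOne_bit]
    rw [eval_double j 0 f (by omega) _ { T with kb := bits l } hu hf hu2]
    obtain _ | b := b
    · rw [Prog.eval_cond, if_neg (by simp), eval_move (by simp)]
      simp only [update_u2, update_u]
      rw [ih (2 * j) (f - j) _ _ rfl (by simp [Tapes.toFun]) rfl rfl
        (by simp [value] at h hv ⊢; omega)]
      simp [value, hu2]
      congr 3
      simp [value] at h hv
      omega
    · simp at hv
      obtain ⟨e, he⟩ : ∃ e, f - j = e + 1 := ⟨f - j - 1, by omega⟩
      rw [Prog.eval_cond, if_pos rfl, eval_act_cons (a := sep) (l := List.replicate e sep)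
        (by simp [Tapes.toFun, he, List.replicate_succ])]
      simp only [Op.succ, onto, pushAll, update_fp, update_u2, Option.toList_some]
      rw [eval_move (by simp)]
      simp only [update_u2, update_u]
      rw [ih (2 * j + 1) e _ _ rfl (by simp [Tapes.toFun, ← List.replicate_succ]) rfl rfl
        (by simp [value] at h hv ⊢; omega)]
      simp [value, hu2]
      congr 3
      simp [value] at h hv
      omega

/-- Some request for a token must fail, either while doubling or when a digit is added; monotonicity
keeps `ovf` set from then on. -/
theorem ovf_unary (l : List Bool) (j f : ℕ) (s : Regs) (T : Tapes)
    (hl : T.kb = bits l) (hu : T.u = List.replicate j sep) (hf : T.fp = List.replicate f sep)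
    (hu2 : T.u2 = []) (h : f + j < value j l) : (unary.eval (s, T.toFun)).1.ovf = true := by
  induction l generalizing j f s T with
  | nil => simp [value] at h
  | cons b l ih =>
    rw [unary, Prog.eval_loop_cons (a := bit b) (l := bits l) wellFormed_unary hl, ← unary]
    simp only [Op.succ, pushAll, update_kb, Prog.eval_seq, isOne_bit]
    by_cases hj : j ≤ f
    · rw [eval_double j 0 f hj _ { T with kb := bits l } hu hf hu2]
      obtain _ | b := b
      · rw [Prog.eval_cond, if_neg (by simp), eval_move (by simp)]
        simp only [update_u2, update_u]
        exact ih (2 * j) (f - j) _ _ rfl (by simp [Tapes.toFun]) rfl rfl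
          (by simp [value] at h ⊢; omega)
      · rw [Prog.eval_cond, if_pos rfl]
        obtain h0 | ⟨e, he⟩ : f - j = 0 ∨ ∃ e, f - j = e + 1 := by
          cases f - j <;> simp
        · rw [eval_act_nil (by simp [Tapes.toFun, h0]), eval_move (by simp)]
          exact (le_unary _).1 (by simp)
        · rw [eval_act_cons (a := sep) (l := List.replicate e sep)
            (by simp [Tapes.toFun, he, List.replicate_succ])]
          simp only [Op.succ, onto, pushAll, update_fp, update_u2, Option.toList_some]
          rw [eval_move (by simp)]
          simp only [update_u2, update_u]
          exact ih (2 * j + 1) e _ _ rfl (by simp [Tapes.toFun, ← List.replicate_succ]) rfl rfl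
            (by simp [value] at h ⊢; omega)
    · refine (le_unary _).1 ((le_eval ?_ _).1 ((le_eval ?_ _).1
        (ovf_double j f (by omega) _ _ hu hf)))
      · simp [move, Prog.All, Regs.Le]
      · simp +contextual [Prog.All, Regs.Le]

/-! ### Comparison of the shapes of matrix and certificate -/

theorem wellFormed_shapeLoop : shapeLoop.WellFormed := by
  simp [shapeLoop, onto, Prog.WellFormed, Prog.Avoids, Op.Avoids]

theorem le_shapeLoop (st : Regs × (Stack → List (Symbol ⊕ Symbol))) :
    st.1.Le (shapeLoop.eval st).1 := by
  refine le_eval ?_ _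
  simp +contextual [shapeLoop, Prog.All, Regs.Le]

theorem eval_shape (l l' : List (Symbol ⊕ Symbol)) (h : l.map isBit = l'.map isBit) (s : Regs)
    (hs : s.c1 = false) (T : Tapes) (hl : T.xa = l) (hl' : T.ci = l') :
    shape.eval (s, T.toFun) = (s, Tapes.toFun { T with
      xa := [], ci := [], ar := l.reverse ++ T.ar, cs := l'.reverse ++ T.cs }) := by
  rw [shape, Prog.eval_seq]
  -- During the loop `c1` records the kind of the last symbol, so the induction must allow any
  -- initial value of `c1`.
  suffices hh : shapeLoop.eval (s, T.toFun) = ({ s with c1 := false }, Tapes.toFun { T with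
      xa := [], ci := [], ar := l.reverse ++ T.ar, cs := l'.reverse ++ T.cs }) by
    rw [hh, eval_act_nil rfl]
    cases s
    simp_all
  clear hs
  induction l generalizing l' s T with
  | nil =>
    rw [shapeLoop, Prog.eval_loop_nil (by simpa [Tapes.toFun] using hl)]
    cases T
    cases s
    simp_all [Op.fail]
  | cons a l ih =>
    obtain _ | ⟨a', l'⟩ := l'
    · simp at h
    rw [shapeLoop, Prog.eval_loop_cons wellFormed_shapeLoop hl, ← shapeLoop]
    simp only [List.map_cons, List.cons.injEq] at h
    simp only [Op.succ, onto, pushAll, update_xa, update_ar, Option.toList_some]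
    rw [eval_act_cons (a := a') (l := l') (by simpa [Tapes.toFun] using hl')]
    simp only [Op.succ, pushAll, update_ci, update_cs, Option.toList_some]
    rw [ih l' h.2 _ _ rfl rfl]
    cases s
    simp [Tapes.toFun, h.1]

/-- A mismatch or a certificate that is too short is caught in the loop, one that is too long by the
final pop from `ci`. -/
theorem ok_shape (l l' : List (Symbol ⊕ Symbol)) (h : l.map isBit ≠ l'.map isBit) (s : Regs)
    (T : Tapes) (hl : T.xa = l) (hl' : T.ci = l') :
    (shape.eval (s, T.toFun)).1.ok = false := by
  rw [shape, Prog.eval_seq]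
  induction l generalizing l' s T with
  | nil =>
    rw [shapeLoop, Prog.eval_loop_nil (by simpa [Tapes.toFun] using hl)]
    obtain _ | ⟨a', l'⟩ := l'
    · simp at h
    simp only [Op.fail]
    rw [eval_act_cons (a := a') (l := l') (by simpa [Tapes.toFun] using hl')]
    simp [Op.succ]
  | cons a l ih =>
    rw [shapeLoop, Prog.eval_loop_cons wellFormed_shapeLoop hl, ← shapeLoop]
    simp only [Op.succ, onto, pushAll, update_xa, update_ar, Option.toList_some]
    obtain _ | ⟨a', l'⟩ := l'
    · rw [eval_act_nil (by simpa [Tapes.toFun] using hl')]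
      refine (le_eval ?_ _).2 ((le_shapeLoop _).2 (by simp))
      simp +contextual [Prog.All, Regs.Le]
    · rw [eval_act_cons (a := a') (l := l') (by simpa [Tapes.toFun] using hl')]
      simp only [Op.succ, pushAll, update_ci, update_cs, Option.toList_some]
      by_cases haa : isBit a = isBit a'
      · exact ih l' (fun hh => h (by simp [haa, hh])) _ _ rfl rfl
      · refine (le_eval ?_ _).2 ((le_shapeLoop _).2 (by simp [Ne.symm haa]))
        simp +contextual [Prog.All, Regs.Le]

/-! ### Parsing the input -/

theorem wellFormed_parse : parse.WellFormed := by
  simp [parse, Prog.WellFormed, Prog.Avoids]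

/-- Each phase is expressed as an equality between two runs of `parse`, the second with the phase
already consumed, so that the phases can be chained by rewriting. -/
theorem eval_parse_bits (a : List Bool) (s : Regs) (hs : s.ph = false) (T : Tapes)
    (rest : List (Symbol ⊕ Symbol)) (h : T.inp = bits a ++ rest) :
    parse.eval (s, T.toFun) =
      parse.eval (s, Tapes.toFun { T with inp := rest, kb := bits a.reverse ++ T.kb }) := by
  induction a generalizing T with
  | nil => cases T; simp_all
  | cons b a ih =>
    rw [parse, Prog.eval_loop_cons (a := bit b) (l := bits a ++ rest) wellFormed_parse
      (by simp [Tapes.toFun, h]), ← parse]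
    simp only [Op.succ, pushAll, update_inp, Prog.eval]
    rw [show parseUpd s (some (bit b)) = s from rfl]
    simp [hs, bit, sep, Tapes.toFun]
    rw [ih _ rfl]

theorem eval_parse_sep (s : Regs) (hs : s.ph = false) (T : Tapes)
    (rest : List (Symbol ⊕ Symbol)) (h : T.inp = sep :: rest) :
    parse.eval (s, T.toFun) = parse.eval ({ s with ph := true },
      Tapes.toFun { T with inp := rest, d := bit true :: T.d }) := by
  rw [parse, Prog.eval_loop_cons (a := sep) (l := rest) wellFormed_parse
    (by simp [Tapes.toFun, h]), ← parse]
  simp [Op.succ, pushAll, Prog.eval, hs, sep, parseUpd, bit, Tapes.toFun]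

/-- The flags `one` and `two` count separators, saturating at two, and thereby detect whether there
are at least two vertices. -/
theorem eval_parse_matrix (X : List Symbol) (s : Regs) (hs : s.ph = true) (T : Tapes)
    (rest : List (Symbol ⊕ Symbol)) (h : T.inp = X.map .inl ++ rest) :
    parse.eval (s, T.toFun) = parse.eval ({ s with
        one := s.one || decide (1 ≤ X.count none)
        two := s.two || (s.one && decide (1 ≤ X.count none)) || decide (2 ≤ X.count none) },
      Tapes.toFun { T with
        inp := rest, xa := (X.map .inl).reverse ++ T.xa
        fp := List.replicate (X.count none) sep ++ T.fp
        nn := List.replicate (X.count none) sep ++ T.nn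
        m := List.replicate (X.count none) sep ++ T.m }) := by
  induction X generalizing s T with
  | nil => cases T; cases s; simp_all
  | cons x X ih =>
    rw [parse, Prog.eval_loop_cons (a := .inl x) (l := X.map .inl ++ rest) wellFormed_parse
      (by simp [Tapes.toFun, h]), ← parse]
    obtain _ | b := x
    · simp [Op.succ, pushAll, Prog.eval, hs, sep, parseUpd, bit, Tapes.toFun]
      rw [ih _ rfl _ rfl]
      congr 2
      · cases s
        simp_all
        grind
      · simp [sep, List.replicate_succ']
    · simp [Op.succ, pushAll, Prog.eval, hs, sep, parseUpd, bit, Tapes.toFun]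
      rw [ih _ hs _ rfl]
      simp [sep, hs]

theorem eval_parse_cert (c : List Symbol) (s : Regs) (hs : s.ph = true) (T : Tapes)
    (h : T.inp = c.map .inr) :
    parse.eval (s, T.toFun) = (s,
      Tapes.toFun { T with inp := [], ci := (c.map .inl).reverse ++ T.ci }) := by
  induction c generalizing T with
  | nil =>
    rw [parse, Prog.eval_loop_nil (by simpa [Tapes.toFun] using h)]
    cases T
    simp_all [Op.fail, parseUpd]
  | cons x X ih =>
    rw [parse, Prog.eval_loop_cons (a := .inr x) (l := X.map .inr) wellFormed_parse
      (by simp [Tapes.toFun, h]), ← parse]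
    simp [Op.succ, pushAll, Prog.eval, hs, sep, parseUpd, bit, Tapes.toFun]
    rw [ih _ rfl]

/-! ### From tests on lists to properties of matrices -/

theorem coverRowOK_map {α : Type} (c : Bool) (f g : α → Bool) (L : List α) :
    coverRowOK c (L.map f) (L.map g) = L.all fun j => !f j || c || g j := by
  induction L with
  | nil => rfl
  | cons a L ih => simp [coverRowOK, ih]

theorem coverOK_map {α : Type} (f : α → List Bool) (g : α → Bool) (L : List α) (l : List Bool) :
    coverOK (L.map g) (L.map f) l = L.all fun i => coverRowOK (g i) (f i) l := by
  induction L with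
  | nil => rfl
  | cons a L ih => simp [coverOK, ih]

theorem diagOK_eq (v : ℕ) (r : List Bool) (h : v < r.length) :
    diagOK (List.replicate v (bit false) ++ [bit true]) r = r[v] := by
  induction v generalizing r with
  | zero =>
    obtain _ | ⟨b, r⟩ := r
    · simp at h
    · cases r <;> simp [diagOK]
  | succ v ih =>
    obtain _ | ⟨b, r⟩ := r
    · simp at h
    · simp [diagOK, List.replicate_succ, ih r (by simpa using h)]

theorem rowsOK_iff (L : List (List Bool)) (k v : ℕ) (R : List (List Bool)) :
    rowsOK L k v R = true ↔ ∀ (i : ℕ) (h : i < R.length), rowOK L k (v + i) R[i] = true := by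
  induction R generalizing v with
  | nil => simp [rowsOK]
  | cons r R ih =>
    rw [rowsOK, Bool.and_eq_true, ih]
    constructor
    · rintro ⟨h1, h2⟩ (_ | i) hi
      · exact h1
      · have := h2 i (by simpa using hi)
        rwa [add_right_comm] at this
    · intro h
      refine ⟨h 0 (by simp), fun i hi => ?_⟩
      have := h (i + 1) (by simpa using hi)
      rwa [← add_assoc, add_right_comm] at this

/-- The rows of a matrix. -/
def matrixRows {n : ℕ} (M : Fin n → Fin n → Bool) : List (List Bool) :=
  (List.finRange n).map fun i => (List.finRange n).map (M i)

theorem length_matrixRows {n : ℕ} (M : Fin n → Fin n → Bool) : (matrixRows M).length = n := by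
  simp [matrixRows]

theorem length_of_mem_matrixRows {n : ℕ} {M : Fin n → Fin n → Bool} {r : List Bool}
    (h : r ∈ matrixRows M) : r.length = n := by
  simp only [matrixRows, List.mem_map] at h
  obtain ⟨i, -, rfl⟩ := h
  simp

theorem map_inl_encodeMatrix {n : ℕ} (M : Fin n → Fin n → Bool) :
    (encodeMatrix M).map Sum.inl = flat (matrixRows M) := by
  simp [encodeMatrix, flat, matrixRows, List.map_flatMap, List.flatMap_map, bits, bit, sep,
    Function.comp_def]

theorem count_none_encodeMatrix {n : ℕ} (M : Fin n → Fin n → Bool) :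
    (encodeMatrix M).count none = n := by
  have h (i : Fin n) : ((List.finRange n).map fun j => some (M i j)).count none = 0 := by
    simp [List.count_eq_zero]
  simp [encodeMatrix, List.count_flatMap, Function.comp_def, h]

theorem rowOK_matrix {n : ℕ} (A : Fin n → Fin n → Bool) (k : ℕ) (v : Fin n) (f : Fin n → Bool) :
    rowOK (matrixRows A) k v ((List.finRange n).map f) = true ↔
      f v = true ∧ (Finset.univ.filter fun w => f w = true).card = k ∧
        ∀ i j, A i j = true → f i = true ∨ f j = true := by
  have hc : ((List.finRange n).map f).count true =
      (Finset.univ.filter fun w => f w = true).card := by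
    rw [List.count, List.countP_map]
    simp [Finset.card, Finset.filter, Fin.univ_def, List.countP_eq_length_filter, Function.comp_def]
  rw [rowOK, diagOK_eq _ _ (by simp), hc, matrixRows, coverOK_map]
  simp only [coverRowOK_map]
  simp only [List.getElem_map, List.getElem_finRange, Bool.and_eq_true, decide_eq_true_eq,
    List.all_eq_true, List.mem_finRange, forall_true_left, Bool.or_eq_true, Bool.not_eq_true', and_assoc]
  refine and_congr (by simp) (and_congr Iff.rfl (forall_congr' fun i => forall_congr' fun j => ?_))
  cases A i j <;> simp

theorem rowsOK_matrix {n : ℕ} (A M : Fin n → Fin n → Bool) (k : ℕ) :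
    rowsOK (matrixRows A) k 0 (matrixRows M) = true ↔
      ∀ v, M v v = true ∧ (Finset.univ.filter fun w => M v w = true).card = k ∧
        ∀ i j, A i j = true → M v i = true ∨ M v j = true := by
  rw [rowsOK_iff]
  constructor
  · intro h v
    have := h v (by simp [matrixRows])
    rw [← rowOK_matrix A k v]
    simpa [matrixRows] using this
  · intro h i hi
    have hi' : i < n := by simpa [matrixRows] using hi
    have := (rowOK_matrix A k ⟨i, hi'⟩ _).2 (h ⟨i, hi'⟩)
    simpa [matrixRows] using this

theorem value_encodePosNum (p : PosNum) : value 0 (Computability.encodePosNum p).reverse = p := by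
  simp only [value, List.foldl_reverse]
  induction p with
  | one => rfl
  | bit0 p ih => rw [Computability.encodePosNum, List.foldr_cons, ih, PosNum.cast_bit0]; simp; ring
  | bit1 p ih => rw [Computability.encodePosNum, List.foldr_cons, ih, PosNum.cast_bit1]; simp; ring

/-- `encodeNat` lists the least significant digit first, whereas `value` reads the most significant
one first; parsing onto a stack provides the reversal. -/
theorem value_encodeNat (k : ℕ) : value 0 (Computability.encodeNat k).reverse = k := by
  conv_rhs => rw [← Num.to_of_nat k]
  rw [Computability.encodeNat]
  cases (k : Num) with
  | zero => rfl
  | pos p => exact value_encodePosNum p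

/-- The pattern of bits and separators determines a string up to the values of its bits. -/
theorem exists_rows (n m : ℕ) (c : List Symbol)
    (h : c.map Option.isSome = (List.replicate m (List.replicate n true ++ [false])).flatten) :
    ∃ R : List (List Bool), R.length = m ∧ (∀ r ∈ R, r.length = n) ∧
      c = R.flatMap fun r => r.map some ++ [none] := by
  induction m generalizing c with
  | zero => exact ⟨[], by simpa using h⟩
  | succ m ih =>
    rw [List.replicate_succ, List.flatten_cons, List.map_eq_append_iff] at h
    obtain ⟨c1, c2, rfl, h1, h2⟩ := h
    obtain ⟨R, hR, hR', rfl⟩ := ih c2 h2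
    rw [List.map_eq_append_iff] at h1
    obtain ⟨d, e, rfl, h3, h4⟩ := h1
    refine ⟨d.map (fun x => x.getD false) :: R, by simp [hR], ?_, ?_⟩
    · simp only [List.mem_cons, forall_eq_or_imp]
      refine ⟨by simpa using congrArg List.length h3, hR'⟩
    · have he : e = [none] := by
        obtain _ | ⟨x, _ | ⟨y, e⟩⟩ := e <;> simp at h4
        simp [h4]
      have hd : d = d.map (fun x => some (x.getD false)) := by
        refine List.ext_getElem (by simp) fun i hi _ => ?_
        have : d[i].isSome = true := by
          have h5 : d[i].isSome ∈ List.replicate n true :=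
            h3 ▸ List.mem_map_of_mem (List.getElem_mem _)
          exact (List.mem_replicate.1 h5).2
        obtain ⟨b, hb⟩ := Option.isSome_iff_exists.1 this
        simp [hb]
      rw [List.flatMap_cons, List.map_map, he]
      congr 2

theorem map_isSome_encodeMatrix {n : ℕ} (M : Fin n → Fin n → Bool) :
    (encodeMatrix M).map Option.isSome =
      (List.replicate n (List.replicate n true ++ [false])).flatten := by
  simp [encodeMatrix, List.flatMap, Function.comp_def]

/-- This justifies testing the certificate against the adjacency matrix: agreement in shape already
makes it a matrix of the right dimension, without any counting. -/
theorem exists_encodeMatrix_iff {n : ℕ} (c : List Symbol) (A : Fin n → Fin n → Bool) :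
    (encodeMatrix A).map Option.isSome = c.map Option.isSome ↔
      ∃ M : Fin n → Fin n → Bool, c = encodeMatrix M := by
  constructor
  · intro h
    rw [map_isSome_encodeMatrix] at h
    obtain ⟨R, hR, hR', rfl⟩ := exists_rows n n c h.symm
    refine ⟨fun i j => (R[i])[j]'(by simp [hR']), ?_⟩
    have hR2 : R = (List.finRange n).map fun i : Fin n => R[i] := by
      refine List.ext_getElem (by simp [hR]) fun i hi _ => by simp
    conv_lhs => rw [hR2]
    rw [List.flatMap_map, encodeMatrix]
    congr 1
    funext i
    congr 1
    refine List.ext_getElem (by simp [hR']) fun i hi _ => by simp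
  · rintro ⟨M, rfl⟩
    rw [map_isSome_encodeMatrix, map_isSome_encodeMatrix]

/-! ### What the verifier accepts -/

/-- An instance and a certificate as the input of the verifier. -/
def encodePair (x : List Symbol × List Symbol) : List (Symbol ⊕ Symbol) :=
  x.1.map .inl ++ x.2.map .inr

/-- The verifier. -/
def accepts (x : List Symbol × List Symbol) : Bool :=
  let s := (program.eval (start, Tapes.toFun { inp := encodePair x })).1
  s.ovf || !s.two || s.ok

theorem polyTime_accepts : Nonempty (Turing.TM2ComputableInPolyTime
    (Computability.encodingProd (Computability.encodingList Symbol)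
      (Computability.encodingList Symbol)).encode Computability.encodeBool accepts) := by
  have : Inhabited (Symbol ⊕ Symbol) := ⟨sep⟩
  refine polyTime_of_prog _ _ accepts program wellFormed_program weight
    (by intro k; cases k <;> decide) weighted_program start .inp (fun s => s.ovf || !s.two || s.ok) fun x => ?_
  have h : (fun _ => [] : Stack → List (Symbol ⊕ Symbol)) = Tapes.toFun {} := by
    funext k; cases k <;> rfl
  rw [h, update_inp]
  rfl

/-- The stacks after parsing. -/
def parsed (a : List Bool) (X c : List Symbol) : Tapes where
  kb := bits a.reverse
  d := [bit true]
  xa := (X.map .inl).reverse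
  fp := List.replicate (X.count none) sep
  nn := List.replicate (X.count none) sep
  m := List.replicate (X.count none) sep
  ci := (c.map .inl).reverse

theorem eval_parse (a : List Bool) (X c : List Symbol) :
    parse.eval (start, Tapes.toFun { inp := encodePair (a.map some ++ [none] ++ X, c) }) =
      (⟨true, decide (1 ≤ X.count none), decide (2 ≤ X.count none), false, true, false, false⟩,
        (parsed a X c).toFun) := by
  rw [eval_parse_bits a start rfl _ (sep :: X.map .inl ++ c.map .inr) (by
    simp [encodePair, bits, bit, sep, Function.comp_def])]
  rw [eval_parse_sep _ rfl _ _ rfl, eval_parse_matrix X _ rfl _ _ rfl,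
    eval_parse_cert c _ rfl _ rfl]
  simp [start, parsed]

theorem exists_tapes (S : Stack → List (Symbol ⊕ Symbol)) : ∃ T : Tapes, S = T.toFun :=
  ⟨⟨S .inp, S .kb, S .xa, S .ar, S .al, S .ci, S .cs, S .fp, S .nn, S .m, S .m2, S .u, S .u2, S .d,
    S .d2, S .r1, S .r2, S .s1, S .s2⟩, by funext k; cases k <;> rfl⟩

variable {n : ℕ} (G : SimpleGraph (Fin n)) (k : ℕ) (c : List Symbol)

theorem accepts_of_le_one (hn : n ≤ 1) : accepts (encodeInstance G k, c) = true := by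
  classical
  have h : ∀ st, (program.eval st).1.two = (parse.eval st).1.two := fun st => two_eval_rest _
  simp only [accepts, h, encodeInstance]
  rw [eval_parse]
  simp [count_none_encodeMatrix, Nat.lt_of_le_of_lt hn one_lt_two]

/-- If the shapes differ, the result of `shape` is not computed. The stacks needed by `unary` are
untouched nevertheless, so overflow can still be decided. -/
theorem exists_tapes_shape (a : List Bool) (X : List Symbol) (s : Regs) :
    ∃ T : Tapes, (shape.eval (s, (parsed a X c).toFun)).2 = T.toFun ∧ T.kb = bits a.reverse ∧
      T.u = [] ∧ T.fp = List.replicate (X.count none) sep ∧ T.u2 = [] := by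
  obtain ⟨T, hT⟩ := exists_tapes (shape.eval (s, (parsed a X c).toFun)).2
  have h (j : Stack) (hj : shape.Avoids j) : T.toFun j = (parsed a X c).toFun j := by
    rw [← hT, hj.eval]
  refine ⟨T, hT, h .kb ?_, h .u ?_, h .fp ?_, h .u2 ?_⟩ <;>
  simp [shape, shapeLoop, onto, Prog.Avoids, Op.Avoids]

theorem accepts_of_lt (hk : n < k) : accepts (encodeInstance G k, c) = true := by
  classical
  suffices h : (program.eval (start,
      Tapes.toFun { inp := encodePair (encodeInstance G k, c) })).1.ovf = true by
    simp [accepts, h]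
  rw [program]
  simp only [Prog.eval_seq]
  refine (le_rows _).1 ?_
  rw [encodeInstance, eval_parse]
  generalize hs : (Regs.mk _ _ _ _ _ _ _) = s
  obtain ⟨T, hT, h1, h2, h3, h4⟩ := exists_tapes_shape c (Computability.encodeNat k)
    (encodeMatrix fun i j => decide (G.Adj i j)) s
  rw [count_none_encodeMatrix] at h3
  rw [← Prod.mk.eta (p := shape.eval _), hT]
  exact ovf_unary _ 0 n _ _ h1 h2 h3 h4 (by rwa [value_encodeNat, add_zero])

theorem ovf_shape (st : Regs × (Stack → List (Symbol ⊕ Symbol))) :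
    (shape.eval st).1.ovf = st.1.ovf := by
  refine Prog.All.eval_rel (R := fun s t : Regs => t.ovf = s.ovf) (fun _ => rfl)
    (fun _ _ _ h h' => h'.trans h) ?_ st
  simp [shape, shapeLoop, Prog.All]

theorem ovf_rows (st : Regs × (Stack → List (Symbol ⊕ Symbol))) :
    (rows.eval st).1.ovf = st.1.ovf := by
  refine Prog.All.eval_rel (R := fun s t : Regs => t.ovf = s.ovf) (fun _ => rfl)
    (fun _ _ _ h h' => h'.trans h) ?_ st
  simp [rows, row, readRow, coverRow, cover, move, Prog.All]

theorem accepts_iff_rowsOK (hn : 2 ≤ n) (hk : k ≤ n) [DecidableRel G.Adj] :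
    accepts (encodeInstance G k, c) = true ↔ ∃ M : Fin n → Fin n → Bool, c = encodeMatrix M ∧
      rowsOK (matrixRows fun i j => decide (G.Adj i j)) k 0 (matrixRows M) = true := by
  classical
  have hi : encodeInstance G k = (Computability.encodeNat k).map some ++ [none] ++
      encodeMatrix fun i j => decide (G.Adj i j) := by
    rw [encodeInstance]; congr!
  set A : Fin n → Fin n → Bool := fun i j => decide (G.Adj i j)
  simp only [accepts, program, Prog.eval_seq]
  rw [hi, eval_parse]
  by_cases hc : ∃ M : Fin n → Fin n → Bool, c = encodeMatrix M
  · obtain ⟨M, rfl⟩ := hc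
    have hh := (exists_encodeMatrix_iff (encodeMatrix M) A).2 ⟨M, rfl⟩
    -- The certificate determines its matrix, which removes the existential quantifier.
    have hM : ∀ M', encodeMatrix M = encodeMatrix M' → M = M' := fun M' h => by
      funext i; exact rows_injective _ _ _ h i (List.mem_finRange i)
    have hu : (∃ M', encodeMatrix M = encodeMatrix M' ∧
        rowsOK (matrixRows A) k 0 (matrixRows M') = true) ↔
        rowsOK (matrixRows A) k 0 (matrixRows M) = true :=
      ⟨fun ⟨M', h1, h2⟩ => hM M' h1 ▸ h2, fun h => ⟨M, rfl, h⟩⟩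
    rw [hu]
    rw [eval_shape ((encodeMatrix A).map .inl).reverse ((encodeMatrix M).map .inl).reverse ?_ _ rfl
      (parsed (Computability.encodeNat k) (encodeMatrix A) (encodeMatrix M)) rfl rfl]
    · rw [eval_unary (Computability.encodeNat k).reverse 0 n _ _ rfl rfl
        (by simp [parsed, count_none_encodeMatrix]) rfl (by simpa [value_encodeNat] using hk)]
      rw [ok_rows (matrixRows A) (fun r h => by
        rw [length_of_mem_matrixRows h, length_matrixRows]) k 0 (matrixRows M) (fun r h => by
        rw [length_of_mem_matrixRows h, length_matrixRows]) (by simp [length_matrixRows])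
        _ rfl rfl _ ?_ ?_ ?_]
      · simp [count_none_encodeMatrix, hn]
      · simp [Tapes.Ready, parsed, count_none_encodeMatrix, length_matrixRows, value_encodeNat,
          map_inl_encodeMatrix]
      · simp [parsed, map_inl_encodeMatrix]
      · simp [parsed, count_none_encodeMatrix, length_matrixRows]
    · simpa [isBit, Function.comp_def] using hh
  · have hc' := fun h => hc ((exists_encodeMatrix_iff c A).1 h)
    refine iff_of_false ?_ fun ⟨M, h, _⟩ => hc ⟨M, h⟩
    generalize hs : (Regs.mk _ _ _ _ _ _ _) = s
    obtain ⟨T, hT, h1, h2, h3, h4⟩ := exists_tapes_shape c (Computability.encodeNat k)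
      (encodeMatrix A) s
    rw [count_none_encodeMatrix] at h3
    -- Rejection requires all three disjuncts of the acceptance test to fail: no overflow because `k
    -- ≤ n`, two rows seen, and `ok` cleared by `shape`.
    have h5 : (rows.eval (unary.eval (shape.eval (s, (parsed (Computability.encodeNat k)
        (encodeMatrix A) c).toFun)))).1.ovf = false := by
      rw [ovf_rows, ← Prod.mk.eta (p := shape.eval _), hT,
        eval_unary _ 0 n _ _ h1 h2 h3 h4 (by simpa [value_encodeNat] using hk)]
      simp only [ovf_shape]
      rw [← hs]
    have h6 : (rows.eval (unary.eval (shape.eval (s, (parsed (Computability.encodeNat k)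
        (encodeMatrix A) c).toFun)))).1.two = true :=
      (two_eval_rest _).trans (by simp [← hs, count_none_encodeMatrix, hn])
    have h7 : (rows.eval (unary.eval (shape.eval (s, (parsed (Computability.encodeNat k)
        (encodeMatrix A) c).toFun)))).1.ok = false :=
      (le_rows _).2 ((le_unary _).2 (ok_shape _ _ (by
        simpa [isBit, Function.comp_def, parsed] using hc') _ _ rfl rfl))
    simp [h5, h6, h7]

theorem accepts_iff (hn : 2 ≤ n) (hk : k ≤ n) :
    accepts (encodeInstance G k, c) = true ↔
      ∃ S : Fin n → Finset (Fin n), c = encodeCertificate S ∧ IsCertificate G k S := by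
  classical
  rw [accepts_iff_rowsOK G k c hn hk]
  simp only [rowsOK_matrix]
  have hcov (S : Finset (Fin n)) : G.IsVertexCover (S : Set (Fin n)) ↔
      ∀ i j, G.Adj i j → i ∈ S ∨ j ∈ S := Iff.rfl
  constructor
  · rintro ⟨M, rfl, h⟩
    refine ⟨fun v => Finset.univ.filter fun w => M v w = true, by simp [encodeCertificate], fun v => ?_⟩
    rw [hcov]
    simpa using ⟨(h v).1, fun i j hij => (h v).2.2 i j (by simpa using hij), (h v).2.1⟩
  · rintro ⟨S, rfl, h⟩
    refine ⟨_, rfl, fun v => ?_⟩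
    have := h v
    rw [hcov] at this
    simpa using ⟨this.1, this.2.2, this.2.1⟩

end Verifier
end EVC

namespace EVC

/-! ### Minimum eternal vertex covers of graphs whose minimum vertex covers are connected -/

section Certificates

set_option linter.unusedSectionVars false

variable {V : Type*} [Fintype V] {G : SimpleGraph V}

theorem Defends.symm {S T : Finset V} {u v : V} (h : Defends G S T u v) : Defends G S T v u := by
  obtain ⟨f, h1, h2, h3⟩ := h
  exact ⟨f, h1, h2, h3.symm⟩

theorem defends_of_injOn {S T : Finset V} {u v : V} (f : V → V) (hmaps : ∀ w ∈ S, f w ∈ T)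
    (hinj : Set.InjOn f S) (hcard : T.card ≤ S.card) (hmove : ∀ w ∈ S, f w = w ∨ G.Adj w (f w))
    (hu : u ∈ S) (huv : f u = v) : Defends G S T u v :=
  ⟨f, ⟨hmaps, hinj, Finset.surjOn_of_injOn_of_card_le f hmaps hinj hcard⟩, hmove,
    Or.inl ⟨hu, huv⟩⟩

theorem defends_self {S : Finset V} {u v : V} (hu : u ∈ S) (hv : v ∈ S) (h : G.Adj u v) :
    Defends G S S u v := by
  classical
  refine defends_of_injOn (Equiv.swap u v) (fun w hw => ?_) (Equiv.injective _).injOn le_rfl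
    (fun w hw => ?_) hu (Equiv.swap_apply_left u v)
  · rw [Equiv.swap_apply_def]
    split_ifs <;> assumption
  · by_cases h1 : w = u
    · subst h1; right; simpa using h
    by_cases h2 : w = v
    · subst h2; right; simpa using h.symm
    · left; exact Equiv.swap_apply_of_ne_of_ne h1 h2

/-! ### Shifting guards along paths -/

/-- Guards can be shifted along a path. -/
theorem exists_perm_of_isPath {a u v : V} (p : G.Walk a u) (hp : p.IsPath) (hv : v ∉ p.support)
    (huv : G.Adj u v) :
    ∃ e : Equiv.Perm V, (∀ w ∉ p.support, w ≠ v → e w = w) ∧ (∀ w ∈ p.support, G.Adj w (e w)) ∧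
      e u = v ∧ e v = a := by
  classical
  induction p with
  | nil =>
    rename_i u
    refine ⟨Equiv.swap u v, fun w hw hwv => Equiv.swap_apply_of_ne_of_ne (by simpa using hw) hwv,
      fun w hw => ?_, by simp, by simp⟩
    obtain rfl : w = u := by simpa using hw
    simpa using huv
  | @cons a b u h p ih =>
    rw [SimpleGraph.Walk.cons_isPath_iff] at hp
    rw [SimpleGraph.Walk.support_cons, List.mem_cons, not_or] at hv
    obtain ⟨e, h1, h2, h3, h4⟩ := ih hp.1 hv.2 huv
    have hea : e a = a := h1 a hp.2 (Ne.symm hv.1)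
    have hne : ∀ w, w ≠ a → w ≠ v → (e * Equiv.swap a v) w = e w := fun w hwa hwv => by
      rw [Equiv.Perm.mul_apply, Equiv.swap_apply_of_ne_of_ne hwa hwv]
    -- The cycle is lengthened by `a`: now `a` goes via `v` to `b`, and `v` goes to `a`, which `e`
    -- fixes. The closing move from `v` to `a` need not follow an edge.
    refine ⟨e * Equiv.swap a v, fun w hw hwv => ?_, fun w hw => ?_, ?_, by simp [hea]⟩
    · rw [SimpleGraph.Walk.support_cons, List.mem_cons, not_or] at hw
      rw [hne w hw.1 hwv, h1 w hw.2 hwv]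
    · rw [SimpleGraph.Walk.support_cons, List.mem_cons] at hw
      by_cases hwa : w = a
      · subst hwa; simpa [h4] using h
      · have hw' := hw.resolve_left hwa
        rw [hne w hwa (fun hh => hv.2 (hh ▸ hw'))]
        exact h2 w hw'
    · have hu : u ∈ p.support := p.end_mem_support
      rw [hne u (fun hh => hp.2 (hh ▸ hu)) (fun hh => hv.2 (hh ▸ hu)), h3]

/-- The value `a` is already taken by `v`, which is not in `S`. A value outside `S ∪ {v}` would be a
fixed point of `e`, hence by injectivity equal to its preimage in `S`. -/
theorem perm_maps {S : Finset V} {v a : V} (e : Equiv.Perm V)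
    (he : ∀ w, w ∉ S → w ≠ v → e w = w) (hv : v ∉ S) (ha : e v = a) :
    ∀ w ∈ S, (e w ∈ S ∨ e w = v) ∧ e w ≠ a := by
  intro w hw
  have hwv : w ≠ v := fun h => hv (h ▸ hw)
  refine ⟨?_, fun h => hwv (e.injective (h.trans ha.symm))⟩
  by_contra! h
  have := e.injective (he _ h.1 h.2)
  rw [this] at h
  exact h.1 hw

/-- A walk from `A` contains a path from `A` that does not meet `A` again. -/
theorem exists_isPath_of_walk {a u : V} (q : G.Walk a u) (S A : Set V)
    (hq : ∀ w ∈ q.support, w ∈ S) (ha : a ∈ A) :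
    ∃ b ∈ A, ∃ p : G.Walk b u, p.IsPath ∧ ∀ w ∈ p.support, w ∈ S ∧ (w ∈ A → w = b) := by
  classical
  -- Start at the last visit of the walk to `A`; shortening the remainder to a path only drops
  -- vertices.
  suffices h : (∀ w ∈ q.support, w ∉ A) ∨
      ∃ b ∈ A, ∃ p : G.Walk b u, ∀ w ∈ p.support, w ∈ S ∧ (w ∈ A → w = b) by
    obtain h | ⟨b, hb, p, hp⟩ := h
    · exact absurd ha (h a q.start_mem_support)
    · exact ⟨b, hb, p.bypass, p.bypass_isPath, fun w hw => hp w (p.support_bypass_subset_support hw)⟩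
  clear ha
  induction q with
  | nil =>
    rename_i u
    by_cases hu : u ∈ A
    · exact Or.inr ⟨u, hu, .nil, fun w hw => ⟨hq w hw, fun _ => by simpa using hw⟩⟩
    · exact Or.inl (by simpa using hu)
  | @cons a b u h q ih =>
    obtain h' | h' := ih fun w hw => hq w (by simp [hw])
    · by_cases ha : a ∈ A
      · refine Or.inr ⟨a, ha, .cons h q, fun w hw => ⟨hq w hw, fun hwA => ?_⟩⟩
        rw [SimpleGraph.Walk.support_cons, List.mem_cons] at hw
        exact hw.resolve_right fun hh => h' w hh hwA
      · refine Or.inl fun w hw => ?_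
        rw [SimpleGraph.Walk.support_cons, List.mem_cons] at hw
        obtain rfl | hw := hw
        · exact ha
        · exact h' w hw
    · exact Or.inr h'

theorem exists_walk_of_preconnected {S : Set V} (hS : (G.induce S).Preconnected) {a u : V}
    (ha : a ∈ S) (hu : u ∈ S) : ∃ q : G.Walk a u, ∀ w ∈ q.support, w ∈ S := by
  obtain ⟨q⟩ := hS ⟨a, ha⟩ ⟨u, hu⟩
  refine ⟨q.map (SimpleGraph.Embedding.induce S).toHom, fun w hw => ?_⟩
  have hs := SimpleGraph.Walk.support_map (SimpleGraph.Embedding.induce S).toHom q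
  obtain ⟨x, -, rfl⟩ := List.mem_map.1 ((congrArg (w ∈ ·) hs).mp hw)
  exact x.2

/-! ### As many guards as a minimum vertex cover -/

/-- If `T` is, among the minimum vertex covers that contain `v`, as close to `S` as possible, then
there is a matching between `S \ T` without an arbitrary vertex `a` and `T \ S` without `v`. -/
theorem exists_matching [DecidableEq V] {S T : Finset V} (hS : IsMinimumVertexCover G S)
    (hT : IsMinimumVertexCover G T) {v a : V} (hvT : v ∈ T)
    (hmax : ∀ T', IsMinimumVertexCover G T' → v ∈ T' → (S ∩ T').card ≤ (S ∩ T).card)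
    (ha : a ∈ S \ T) :
    ∃ g : V → V, Set.InjOn g ((S \ T).erase a) ∧
      ∀ w ∈ (S \ T).erase a, g w ∈ (T \ S).erase v ∧ G.Adj w (g w) := by
  classical
  have hAB : (S \ T).card = (T \ S).card := by
    have := hS.2 T hT.1
    have := hT.2 S hS.1
    exact Finset.card_sdiff_comm (by omega)
  obtain ⟨f, hf, hf'⟩ := (Finset.all_card_le_biUnion_card_iff_exists_injective
    (fun w : ((S \ T).erase a : Finset V) => ((T \ S).erase v).filter fun b => G.Adj w b)).1 (by
    intro A
    by_contra! hA
    set N := A.biUnion fun w => ((T \ S).erase v).filter fun b => G.Adj w b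
    set A' : Finset V := A.map (Function.Embedding.subtype _)
    have hA' : ∀ x ∈ A', x ∈ (S \ T).erase a := by
      intro x hx
      simp only [A', Finset.mem_map] at hx
      obtain ⟨y, -, rfl⟩ := hx
      exact y.2
    have hcardA : A'.card = A.card := Finset.card_map _
    set B' := (T \ S).erase v \ N
    have hBA : ∀ x ∈ A', ∀ y ∈ B', ¬ G.Adj x y := by
      intro x hx y hy hxy
      simp only [A', Finset.mem_map] at hx
      obtain ⟨w, hw, rfl⟩ := hx
      rw [Finset.mem_sdiff] at hy
      exact hy.2 (Finset.mem_biUnion.2 ⟨w, hw, Finset.mem_filter.2 ⟨hy.1, hxy⟩⟩)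
    have hB'T : B' ⊆ T := fun x hx =>
      (Finset.mem_sdiff.1 (Finset.mem_of_mem_erase (Finset.mem_sdiff.1 hx).1)).1
    have hB'S : ∀ x ∈ B', x ∉ S := fun x hx =>
      (Finset.mem_sdiff.1 (Finset.mem_of_mem_erase (Finset.mem_sdiff.1 hx).1)).2
    have hvB' : v ∉ B' := fun h => Finset.notMem_erase _ _ (Finset.mem_sdiff.1 h).1
    have hNs : N ⊆ (T \ S).erase v := fun x hx => by
      obtain ⟨w, -, hw⟩ := Finset.mem_biUnion.1 hx
      exact (Finset.mem_filter.1 hw).1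
    have hA's : A' ⊆ S \ T := fun x hx => Finset.mem_of_mem_erase (hA' x hx)
    have hc1 : B'.card = ((T \ S).erase v).card - N.card := Finset.card_sdiff_of_subset hNs
    have hc2 : ((S \ T) \ A').card = (S \ T).card - A'.card := Finset.card_sdiff_of_subset hA's
    have hc3 : (T \ S).card ≤ ((T \ S).erase v).card + 1 :=
      Nat.sub_le_iff_le_add.1 Finset.pred_card_le_card_erase
    have hc4 : N.card ≤ ((T \ S).erase v).card := Finset.card_le_card hNs
    -- Let `A'` violate Hall's condition. Exchanging `B'`, the vertices of `T \ S` other than `v`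
    -- without neighbours in `A'`, for `(S \ T) \ A'` does not increase the size. The new set keeps
    -- `v` and `S ∩ T` and gains `a`, against the choice of `T`.
    let T' := (T \ B') ∪ ((S \ T) \ A')
    have hT'c : T'.card ≤ T.card := by
      have h1 : T'.card ≤ (T \ B').card + ((S \ T) \ A').card := Finset.card_union_le _ _
      have h2 : (T \ B').card = T.card - B'.card := Finset.card_sdiff_of_subset hB'T
      have h3 := Finset.card_le_card hB'T
      omega
    have hcov : G.IsVertexCover (T' : Set V) := by
      have key : ∀ x y, G.Adj x y → x ∈ T → x ∈ T' ∨ y ∈ T' := by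
        intro x y hxy hx
        by_cases hxB : x ∈ B'
        · right
          -- A removed vertex lies outside `S`, so its neighbours are in `S`, and not in `A'`; the
          -- exchange keeps or adds all of them.
          have hyS : y ∈ S := (hS.1 hxy).resolve_left (hB'S x hxB)
          by_cases hyT : y ∈ T
          · exact Finset.mem_union_left _ (Finset.mem_sdiff.2 ⟨hyT, fun h => hB'S y h hyS⟩)
          · exact Finset.mem_union_right _ (Finset.mem_sdiff.2 ⟨Finset.mem_sdiff.2 ⟨hyS, hyT⟩,
              fun h => hBA y h x hxB hxy.symm⟩)
        · exact Or.inl (Finset.mem_union_left _ (Finset.mem_sdiff.2 ⟨hx, hxB⟩))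
      intro x y hxy
      obtain h | h := hT.1 hxy
      · exact key x y hxy h
      · exact (key y x hxy.symm h).symm
    have hT'min : IsMinimumVertexCover G T' := ⟨hcov, fun U hU => hT'c.trans (hT.2 U hU)⟩
    have hlt : (S ∩ T).card < (S ∩ T').card := by
      refine Finset.card_lt_card (Finset.ssubset_iff_of_subset ?_ |>.2 ⟨a, ?_, ?_⟩)
      · intro x hx
        rw [Finset.mem_inter] at hx ⊢
        exact ⟨hx.1, Finset.mem_union_left _ (Finset.mem_sdiff.2
          ⟨hx.2, fun h => hB'S x h hx.1⟩)⟩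
      · exact Finset.mem_inter.2 ⟨(Finset.mem_sdiff.1 ha).1, Finset.mem_union_right _
          (Finset.mem_sdiff.2 ⟨ha, fun h => Finset.notMem_erase _ _ (hA' a h)⟩)⟩
      · exact fun h => (Finset.mem_sdiff.1 ha).2 (Finset.mem_inter.1 h).2
    exact absurd (hmax T' hT'min (Finset.mem_union_left _ (Finset.mem_sdiff.2 ⟨hvT, hvB'⟩)))
      (not_le.2 hlt))
  refine ⟨fun w => if h : w ∈ (S \ T).erase a then f ⟨w, h⟩ else w, ?_, ?_⟩
  · intro x hx y hy hxy
    simp only [Finset.mem_coe] at hx hy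
    simp only [dif_pos hx, dif_pos hy] at hxy
    exact congrArg Subtype.val (hf hxy)
  · intro w hw
    simp only [dif_pos hw]
    exact Finset.mem_filter.1 (hf' ⟨w, hw⟩)

theorem exists_defends_of_minimum {S : Finset V} (hS : IsMinimumVertexCover G S)
    (hconn : (G.induce (S : Set V)).Preconnected) {u v : V} (huv : G.Adj u v) (hu : u ∈ S)
    (hv : v ∉ S) (hex : ∃ T : Finset V, IsMinimumVertexCover G T ∧ v ∈ T) :
    ∃ T : Finset V, IsMinimumVertexCover G T ∧ Defends G S T u v := by
  classical
  obtain ⟨T, hT, hmax⟩ := Finset.exists_max_image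
    (Finset.univ.filter fun T : Finset V => IsMinimumVertexCover G T ∧ v ∈ T)
    (fun T => (S ∩ T).card) (by simpa [Finset.Nonempty] using hex)
  simp only [Finset.mem_filter, Finset.mem_univ, true_and, and_imp] at hT hmax
  obtain ⟨hT, hvT⟩ := hT
  have hcard : S.card = T.card := le_antisymm (hS.2 T hT.1) (hT.2 S hS.1)
  have hAB : (S \ T).card = (T \ S).card := Finset.card_sdiff_comm hcard
  obtain ⟨a₀, ha₀⟩ : (S \ T).Nonempty := by
    rw [← Finset.card_pos, hAB, Finset.card_pos]
    exact ⟨v, Finset.mem_sdiff.2 ⟨hvT, hv⟩⟩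
  obtain ⟨q, hq⟩ := exists_walk_of_preconnected hconn (Finset.mem_sdiff.1 ha₀).1 hu
  obtain ⟨a, ha, p, hp, hp'⟩ := exists_isPath_of_walk q (S : Set V) ((S \ T : Finset V) : Set V)
    hq ha₀
  have ha : a ∈ S \ T := ha
  obtain ⟨e, he1, he2, he3, he4⟩ := exists_perm_of_isPath p hp (fun h => hv (hp' v h).1) huv
  obtain ⟨g, hg, hg'⟩ := exists_matching hS hT hvT hmax ha
  have hav : a ≠ v := fun h => hv (h ▸ (Finset.mem_sdiff.1 ha).1)
  -- The path meets `S \ T` only in `a`, so the shift carries `(S ∩ T) ∪ {a}` into `(S ∩ T) ∪ {v}`.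
  have hmaps := perm_maps (S := insert a (S ∩ T)) e (fun w hw hwv => he1 w (fun hw' => hw (by
      obtain ⟨h1, h2⟩ := hp' w hw'
      by_cases hwT : w ∈ T
      · exact Finset.mem_insert_of_mem (Finset.mem_inter.2 ⟨h1, hwT⟩)
      · rw [h2 (Finset.mem_coe.2 (Finset.mem_sdiff.2 ⟨h1, hwT⟩))]
        exact Finset.mem_insert_self _ _)) hwv)
    (by simp [hav.symm, hv]) he4
  have hmem : ∀ w ∈ S, w ∉ (S \ T).erase a → w ∈ insert a (S ∩ T) := by
    intro w hw hw'
    simp only [Finset.mem_erase, Finset.mem_sdiff, Finset.mem_insert, Finset.mem_inter] at hw' ⊢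
    tauto
  have hmaps' : ∀ w ∈ S, w ∉ (S \ T).erase a → e w = v ∨ e w ∈ S ∩ T := by
    intro w hw hw'
    have := hmaps w (hmem w hw hw')
    simp only [Finset.mem_insert] at this
    tauto
  refine ⟨T, hT, defends_of_injOn (fun w => if w ∈ (S \ T).erase a then g w else e w)
    (fun w hw => ?_) ?_ hcard.ge (fun w hw => ?_) hu ?_⟩
  · split_ifs with h
    · exact (Finset.mem_sdiff.1 (Finset.mem_of_mem_erase (hg' w h).1)).1
    · obtain h' | h' := hmaps' w hw h
      · rwa [h']
      · exact (Finset.mem_inter.1 h').2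
  · have hne : ∀ x ∈ (S \ T).erase a, ∀ y ∈ S, y ∉ (S \ T).erase a → g x ≠ e y := by
      intro x hx y hy hy' h
      have h1 := (hg' x hx).1
      simp only [Finset.mem_erase, Finset.mem_sdiff] at h1
      obtain h' | h' := hmaps' y hy hy'
      · exact h1.1 (h.trans h')
      · exact h1.2.2 (h ▸ (Finset.mem_inter.1 h').1)
    intro x hx y hy hxy
    dsimp only at hxy
    split_ifs at hxy with h1 h2 h2
    · exact hg h1 h2 hxy
    · exact absurd hxy (hne x h1 y hy h2)
    · exact absurd hxy.symm (hne y h2 x hx h1)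
    · exact e.injective hxy
  · split_ifs with h
    · exact Or.inr (hg' w h).2
    · by_cases hws : w ∈ p.support
      · exact Or.inr (he2 w hws)
      · exact Or.inl (he1 w hws fun h => hv (h ▸ hw))
  · have hua : u ∉ (S \ T).erase a := fun h =>
      Finset.ne_of_mem_erase h ((hp' u p.end_mem_support).2 (Finset.mem_of_mem_erase h))
    simp only [if_neg hua, he3]

theorem evc_le {S : Finset V} (h : IsEternalVertexCover G S) : evc G ≤ S.card :=
  Nat.sInf_le ⟨S, h, rfl⟩

theorem exists_isMinimumVertexCover (G : SimpleGraph V) :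
    ∃ S : Finset V, IsMinimumVertexCover G S := by
  classical
  obtain ⟨S, hS, hmin⟩ := Finset.exists_min_image
    (Finset.univ.filter fun S : Finset V => G.IsVertexCover (S : Set V)) Finset.card
    ⟨Finset.univ, by simp⟩
  simp only [Finset.mem_filter, Finset.mem_univ, true_and] at hS hmin
  exact ⟨S, hS, hmin⟩

theorem evc_le_of_forall_exists_minimum
    (hconn : ∀ S : Finset V, IsMinimumVertexCover G S → (G.induce (S : Set V)).Preconnected)
    (hex : ∀ v, ∃ S : Finset V, IsMinimumVertexCover G S ∧ v ∈ S) {S : Finset V}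
    (hS : IsMinimumVertexCover G S) : evc G ≤ S.card := by
  refine evc_le ⟨{T | IsMinimumVertexCover G T}, ⟨fun T hT =>
    ⟨hT.1, le_antisymm (hT.2 S hS.1) (hS.2 T hT.1)⟩, fun T hT u v huv => ?_⟩, hS⟩
  by_cases hu : u ∈ T
  · by_cases hv : v ∈ T
    · exact ⟨T, hT, defends_self hu hv huv⟩
    · exact exists_defends_of_minimum hT (hconn T hT) huv hu hv (hex v)
  · have hv : v ∈ T := (hT.1 huv).resolve_left hu
    obtain ⟨U, hU, h⟩ := exists_defends_of_minimum hT (hconn T hT) huv.symm hv hu (hex u)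
    exact ⟨U, hU, h.symm⟩

/-! ### One guard more than a connected vertex cover -/

/-- All neighbours of the extra vertex `x` are in `S`, so connectedness of `S` gives a walk from `x`
through `S` to `u`. Shifting along a path inside it vacates `x` and fills `v`. -/
theorem exists_defends_insert [DecidableEq V] (hG : G.Connected) {S : Finset V}
    (hS : G.IsVertexCover (S : Set V)) (hconn : (G.induce (S : Set V)).Preconnected) {x u v : V}
    (hx : x ∉ S) (huv : G.Adj u v) (hu : u ∈ insert x S) (hv : v ∉ insert x S) :
    Defends G (insert x S) (insert v S) u v := by
  rw [Finset.mem_insert, not_or] at hv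
  have hux : u ≠ x := by
    rintro rfl
    exact (hS huv).elim hx hv.2
  have huS : u ∈ S := (Finset.mem_insert.1 hu).resolve_left hux
  have : Nontrivial V := ⟨u, x, hux⟩
  obtain ⟨y, hy⟩ := hG.preconnected.exists_adj_of_nontrivial x
  have hyS : y ∈ S := (hS hy).resolve_left hx
  obtain ⟨q, hq⟩ := exists_walk_of_preconnected hconn hyS huS
  obtain ⟨a, ha, p, hp, hp'⟩ := exists_isPath_of_walk (.cons hy q)
    ((insert x S : Finset V) : Set V) {x} (by
      intro w hw
      rw [SimpleGraph.Walk.support_cons, List.mem_cons] at hw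
      obtain rfl | hw := hw
      · simp
      · simp only [Finset.coe_insert]
        exact Set.mem_insert_of_mem _ (hq w hw)) rfl
  obtain rfl : a = x := ha
  have hvS' : v ∉ insert a S := by simp [hv.1, hv.2]
  obtain ⟨e, he1, he2, he3, he4⟩ := exists_perm_of_isPath p hp (fun h => hvS' (hp' v h).1) huv
  have hmaps := perm_maps e (fun w hw hwv => he1 w (fun h => hw (hp' w h).1) hwv) hvS' he4
  refine defends_of_injOn e (fun w hw => ?_) e.injective.injOn ?_ (fun w hw => ?_) hu he3
  · have := hmaps w hw
    simp only [Finset.mem_insert] at this ⊢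
    tauto
  · rw [Finset.card_insert_of_notMem hx, Finset.card_insert_of_notMem hv.2]
  · by_cases hws : w ∈ p.support
    · exact Or.inr (he2 w hws)
    · exact Or.inl (he1 w hws fun h => hvS' (h ▸ hw))

theorem evc_le_card_add_one (hG : G.Connected) {S : Finset V}
    (hS : G.IsVertexCover (S : Set V)) (hconn : (G.induce (S : Set V)).Preconnected)
    (hne : S.card < Fintype.card V) : evc G ≤ S.card + 1 := by
  classical
  obtain ⟨x, -, hx⟩ := Finset.exists_mem_notMem_of_card_lt_card (t := Finset.univ) hne
  rw [← Finset.card_insert_of_notMem hx]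
  refine evc_le ⟨{T | ∃ y, y ∉ S ∧ T = insert y S}, ⟨?_, ?_⟩, x, hx, rfl⟩
  · rintro _ ⟨y, hy, rfl⟩
    refine ⟨hS.subset (by simp), ?_⟩
    rw [Finset.card_insert_of_notMem hx, Finset.card_insert_of_notMem hy]
  · rintro _ ⟨y, hy, rfl⟩ u v huv
    by_cases hu : u ∈ insert y S
    · by_cases hv : v ∈ insert y S
      · exact ⟨_, ⟨y, hy, rfl⟩, defends_self hu hv huv⟩
      · exact ⟨_, ⟨v, fun h => hv (Finset.mem_insert_of_mem h), rfl⟩,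
          exists_defends_insert hG hS hconn hy huv hu hv⟩
    · have hv : v ∈ insert y S := Finset.mem_insert_of_mem
        ((hS huv).resolve_left fun h => hu (Finset.mem_insert_of_mem h))
      exact ⟨_, ⟨u, fun h => hu (Finset.mem_insert_of_mem h), rfl⟩,
        (exists_defends_insert hG hS hconn hy huv.symm hv hu).symm⟩

/-! ### The criterion for `evc G ≤ k` -/

/-- A second vertex is needed for an edge at `v` to attack: a single vertex has `evc G = 0` but is
in no cover of size 0. -/
theorem exists_cover_of_evc_le (hG : G.Connected) {k : ℕ} (hk : k ≤ Fintype.card V)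
    (h2 : 2 ≤ Fintype.card V) (h : evc G ≤ k) (v : V) :
    ∃ T : Finset V, v ∈ T ∧ G.IsVertexCover (T : Set V) ∧ T.card = k := by
  classical
  obtain ⟨S, ⟨C, hC, hSC⟩, hS⟩ := Nat.sInf_mem
    (s := {k : ℕ | ∃ S : Finset V, IsEternalVertexCover G S ∧ S.card = k})
    ⟨_, Finset.univ, isEternalVertexCover_univ G, rfl⟩
  have hS : S.card = evc G := hS
  obtain ⟨T, hTC, hvT⟩ : ∃ T ∈ C, v ∈ T := by
    by_cases hv : v ∈ S
    · exact ⟨S, hSC, hv⟩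
    · have : Nontrivial V := Fintype.one_lt_card_iff_nontrivial.1 h2
      obtain ⟨u, hu⟩ := hG.preconnected.exists_adj_of_nontrivial v
      obtain ⟨T, hT, f, hf, -, h' | h'⟩ := hC.2 S hSC u v hu.symm
      · exact ⟨T, hT, h'.2 ▸ hf.mapsTo h'.1⟩
      · exact absurd h'.1 hv
  obtain ⟨hT1, hT2⟩ := hC.1 T hTC
  obtain ⟨U, hTU, hU⟩ := Finset.exists_superset_card_eq (s := T) (n := k) (by omega) hk
  exact ⟨U, hTU hvT, hT1.subset (by simpa using hTU), hU⟩

/-- For a connected graph whose minimum vertex covers are connected, the vertex covers of size `k`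
through the vertices certify that `k` guards suffice. -/
theorem evc_le_iff_exists_isCertificate (hG : AllMinimumVertexCoversConnected G) {k : ℕ}
    (hk : k ≤ Fintype.card V) (h2 : 2 ≤ Fintype.card V) :
    evc G ≤ k ↔ ∃ S : V → Finset V, IsCertificate G k S := by
  constructor
  · intro h
    choose S hS using exists_cover_of_evc_le hG.1 hk h2 h
    exact ⟨S, hS⟩
  · rintro ⟨S, hS⟩
    obtain ⟨T, hT⟩ := exists_isMinimumVertexCover G
    have hle : T.card ≤ k := by
      obtain ⟨v⟩ := hG.1.nonempty
      exact (hS v).2.2 ▸ hT.2 _ (hS v).2.1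
    obtain rfl | hlt := hle.eq_or_lt
    · exact evc_le_of_forall_exists_minimum hG.2
        (fun v => ⟨S v, ⟨(hS v).2.1, fun U hU => (hS v).2.2 ▸ hT.2 U hU⟩, (hS v).1⟩) hT
    -- Since `T.card < k ≤ Fintype.card V`, there is a vertex outside `T` for the extra guard.
    · exact (evc_le_card_add_one hG.1 hT.1 (hG.2 T hT) (by omega)).trans hlt

end Certificates
end EVC

namespace EVC

/-! ### Assembly of the verifier -/

namespace Verifier

/-- The instance contains a matrix of the same dimension, so the identity polynomial suffices. -/
theorem length_encodeCertificate_le {n : ℕ} (G : SimpleGraph (Fin n)) (k : ℕ)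
    (S : Fin n → Finset (Fin n)) :
    (encodeCertificate S).length ≤ (Polynomial.X : Polynomial ℕ).eval
      (encodeInstance G k).length := by
  rw [Polynomial.eval_X, encodeCertificate, encodeInstance, length_encodeMatrix,
    List.length_append, length_encodeMatrix]
  omega

theorem evc_le_card {V : Type*} [Fintype V] (G : SimpleGraph V) : evc G ≤ Fintype.card V :=
  evc_le (isEternalVertexCover_univ G)

theorem mem_lang_iff {n : ℕ} (G : SimpleGraph (Fin n)) (k : ℕ) :
    encodeInstance G k ∈ evcProblem.lang ↔ evc G ≤ k := by
  constructor
  · rintro ⟨m, H, l, h, hl⟩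
    obtain ⟨rfl, rfl, rfl⟩ := encodeInstance_injective G H k l h
    exact hl
  · exact fun h => ⟨n, G, k, rfl, h⟩

theorem isNPVerifier_accepts : IsNPVerifier evcProblem accepts Polynomial.X where
  polyTime := polyTime_accepts
  correct := by
    rintro _ ⟨n, G, k, rfl, hG⟩
    rw [mem_lang_iff]
    by_cases hn : 2 ≤ n
    · by_cases hk : k ≤ n
      · rw [evc_le_iff_exists_isCertificate hG (by simpa using hk) (by simpa using hn)]
        constructor
        · rintro ⟨S, hS⟩
          exact ⟨encodeCertificate S, length_encodeCertificate_le G k S,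
            (accepts_iff G k _ hn hk).2 ⟨S, rfl, hS⟩⟩
        · rintro ⟨c, -, hc⟩
          obtain ⟨S, -, hS⟩ := (accepts_iff G k c hn hk).1 hc
          exact ⟨S, hS⟩
      · refine iff_of_true ((evc_le_card G).trans ?_) ⟨[], by simp, accepts_of_lt G k [] (by omega)⟩
        rw [Fintype.card_fin]
        omega
    · refine iff_of_true ?_ ⟨[], by simp, accepts_of_le_one G k [] (by omega)⟩
      have hsub : Subsingleton (Fin n) := Fin.subsingleton_iff_le_one.2 (by omega)
      -- With at most one vertex there is nothing to attack, and no guard is needed.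
      have h0 : IsEternalVertexCover G ∅ := by
        refine ⟨{∅}, ⟨?_, ?_⟩, rfl⟩
        · rintro S rfl
          exact ⟨fun u v h => (h.ne (Subsingleton.elim u v)).elim, rfl⟩
        · exact fun S _ u v h => (h.ne (Subsingleton.elim u v)).elim
      exact (evc_le h0).trans (Nat.zero_le k)

end Verifier
end EVC

theorem mainTheorem7 :
    EVC.InNP EVC.evcProblem ∧
    ∃ (V : List EVC.Symbol × List EVC.Symbol → Bool) (p : Polynomial ℕ),
      EVC.IsNPVerifier EVC.evcProblem V p ∧
      ∀ (n : ℕ) (G : SimpleGraph (Fin n)) (k : ℕ), 2 ≤ n → k ≤ n →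
        (∀ S : Fin n → Finset (Fin n),
          (EVC.encodeCertificate S).length ≤ p.eval (EVC.encodeInstance G k).length) ∧
        ∀ c : List EVC.Symbol,
          (V (EVC.encodeInstance G k, c) = true ↔
            ∃ S : Fin n → Finset (Fin n),
              c = EVC.encodeCertificate S ∧ EVC.IsCertificate G k S) :=
  ⟨⟨_, _, EVC.Verifier.isNPVerifier_accepts⟩, _, _, EVC.Verifier.isNPVerifier_accepts,
    fun _ G k hn hk => ⟨EVC.Verifier.length_encodeCertificate_le G k,
      fun c => EVC.Verifier.accepts_iff G k c hn hk⟩⟩
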